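/- Let $\ell,m\ge 3$ be integers with $(\ell-2)(m-2)>4$, and let $X_{\ell,m}$ be the $\ell$-regular graph that is the $1$-skeleton of the regular tessellation of the hyperbolic plane by $m$-gons, $\ell$ of them meeting at each vertex. Explicitly, let $$W=\langle s_0,s_1,s_2\mid s_0^2=s_1^2=s_2^2=(s_0s_1)^m=(s_1s_2)^\ell=(s_0s_2)^2=1\rangle$$ be the symmetry group of the tessellation; the vertices of $X_{\ell,m}$ are the left cosets of $P=\langle s_1,s_2\rangle$ in $W$, and the edges join $gP$ to $gs_0P$ for $g\in W$. Fix an arbitrary base vertex $*$, let $|x|$ be the graph distance from $*$ to the vertex $x$, and let $$F_{\ell,m}(X)=\sum_{x\in V(X_{\ell,m})}X^{|x|}=\sum_{n\ge0}f_nX^n$$ be the growth series, so that $f_n$ is the number of vertices at distance $n$ from $*$ (which is finite). Then there exist real constants $K>0$, $\lambda>1$ and $R>0$ such that $$K\lambda^n-R<f_n<K\lambda^n+R\qquad\text{for all } n\ge0,$$ and $\lambda$ is a Salem number: $\lambda>1$ is an algebraic integer, $\lambda^{-1}$ is a conjugate of $\lambda$, and all conjugates of $\lambda$ other than $\lambda^{\pm1}$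 have absolute value $1$. -/

import Mathlib

/-- The Coxeter matrix of the group `[m, ℓ]`, the full symmetry group of the regular tessellation
by `m`-gons with `ℓ` of them around each vertex. Its three generators are the reflections in the
sides of a triangle with angles `π / m`, `π / ℓ`, `π / 2`: `s₀`, `s₁`, `s₂` move a given flag
(vertex, edge, face) to the flag that differs from it only in the vertex, the edge, the face. -/
def tessellationMatrix (ℓ m : ℕ) (hℓ : 3 ≤ ℓ) (hm : 3 ≤ m) : CoxeterMatrix (Fin 3) where
  M := !![1, m, 2; m, 1, ℓ; 2, ℓ, 1]
  isSymm := by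
    ext i j
    fin_cases i <;> fin_cases j <;> rfl
  diagonal := by
    intro i
    fin_cases i <;> rfl
  off_diagonal := by
    intro i j hij
    fin_cases i <;> fin_cases j <;> simp at hij ⊢ <;> omega

/-- The symmetry group `[m, ℓ]` of the tessellation; its elements correspond to the flags. -/
abbrev TessellationGroup (ℓ m : ℕ) (hℓ : 3 ≤ ℓ) (hm : 3 ≤ m) : Type :=
  (tessellationMatrix ℓ m hℓ hm).Group

/-- The stabilizer of the base vertex (dihedral, of order `2 * ℓ`). -/
def vertexStabilizer (ℓ m : ℕ) (hℓ : 3 ≤ ℓ) (hm : 3 ≤ m) :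
    Subgroup (TessellationGroup ℓ m hℓ hm) :=
  Subgroup.closure
    {(tessellationMatrix ℓ m hℓ hm).simple 1, (tessellationMatrix ℓ m hℓ hm).simple 2}

/-- The vertices of the tessellation: the orbit of the base vertex. -/
abbrev TessellationVertex (ℓ m : ℕ) (hℓ : 3 ≤ ℓ) (hm : 3 ≤ m) : Type :=
  TessellationGroup ℓ m hℓ hm ⧸ vertexStabilizer ℓ m hℓ hm

/-- The `1`-skeleton of the tessellation: the edges are the translates of the base edge, which
joins the base vertex to its image under `s₀`. -/
def tessellationGraph (ℓ m : ℕ) (hℓ : 3 ≤ ℓ) (hm : 3 ≤ m) :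
    SimpleGraph (TessellationVertex ℓ m hℓ hm) :=
  SimpleGraph.fromRel fun x y =>
    ∃ g : TessellationGroup ℓ m hℓ hm,
      x = QuotientGroup.mk g ∧
        y = QuotientGroup.mk (g * (tessellationMatrix ℓ m hℓ hm).simple 0)

/-- The vertices at graph distance exactly `n` from `o`. -/
def graphSphere {V : Type*} (G : SimpleGraph V) (o : V) (n : ℕ) : Set V :=
  {x | G.edist o x = n}

/-- The growth series `∑ x, X ^ |x|`, where `|x|` is the graph distance from `o` to `x`: the
coefficient of `X ^ n` is the number of vertices at distance `n` from `o`. -/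
noncomputable def growthSeries {V : Type*} (G : SimpleGraph V) (o : V) : PowerSeries ℕ :=
  PowerSeries.mk fun n => (graphSphere G o n).ncard

/-- Salem numbers: algebraic integers `r > 1` such that all conjugates of `r` other than `r` and
`r⁻¹` have absolute value `1`. That `r⁻¹` is indeed a conjugate of `r` is part of the definition
(so that integers are excluded); quadratic units are allowed. -/
def IsSalemNumber (r : ℝ) : Prop :=
  1 < r ∧ IsIntegral ℤ r ∧ Polynomial.aeval r⁻¹ (minpoly ℚ r) = 0 ∧
    ∀ z : ℂ, Polynomial.aeval z (minpoly ℚ r) = 0 → z ≠ (r : ℂ) → z ≠ (r : ℂ)⁻¹ → ‖z‖ = 1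

/-! The elements of `W` are the flags of the tessellation, and everything is read off their right
descent sets. The geometric representation turns descents into signs: `i` is a right descent of `g`
exactly when `g` maps the simple root αᵢ to a negative root. Curvature enters through one
inequality: the roots s₀α₁ and s₂α₁ have canonical form at most -1, so their lines do not cross and
no element makes both roots negative (`IsRealRoot.not_nonpos_of_two_le_cosForm`,
`not_isRightDescent_pair`).

Distances are then determined locally. A face has either one lowest vertex or two, the ends of a
horizontal edge on which it rests. If m is odd, a face with one lowest vertex has a horizontal top
edge, and the face beyond that edge rests on it; a face with two lowest vertices has a single top
vertex. The resulting level increments agree along both ways round every rank-two residue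
(`levelStep_consistent`), so they integrate to a function `level` on flags. It changes by at most 1
along an edge, and every vertex other than the base has a neighbour one level lower; hence it is the
graph distance (`edist_eq_level`).

Weight flags, vertices, edges and faces by X to their lowest level. Counting the flags at a vertex,
an edge and a face gives linear relations between these series, and inclusion-exclusion over descent
sets gives Euler's relation: vertices - edges + faces = 1. Elimination yields F * D = N with an
explicit antireciprocal denominator D (`levelSeries_mul_even`, `levelSeries_mul_odd`).

On the unit circle D becomes a sine sum with deg D - 3 sign changes in a half period. Together with
1 and a pair λ, λ⁻¹, which exists because the hypothesis (ℓ-2)(m-2) > 4 says exactly that D'(1) < 0,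
this accounts for all roots, so they are simple (`exists_roots`). Partial fractions give f_n = Kλ^n
+ O(1). If K were not positive, f_n would be bounded and λ⁻¹ would be a zero of N, which has none in
(0, 1). The constant term -1 of D forces λ⁻¹ to be a conjugate of λ. -/

namespace CoxeterSystem

variable {B W : Type*} [Group W] {M : CoxeterMatrix B}

/-! ### The geometric representation of a Coxeter group with finite entries -/

section Geometric

/-- Minus twice the canonical bilinear form of a Coxeter matrix, as a matrix. -/
noncomputable def cosCoeff (M : CoxeterMatrix B) (i j : B) : ℝ := 2 * Real.cos (Real.pi / M i j)

theorem cosCoeff_self (i : B) : cosCoeff M i i = -2 := by simp [cosCoeff]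

theorem cosCoeff_comm (i j : B) : cosCoeff M i j = cosCoeff M j i := by
  rw [cosCoeff, cosCoeff, M.symmetric i j]

theorem two_mul_cos_mul_sin (x t : ℝ) :
    2 * Real.cos t * Real.sin x = Real.sin (x + t) + Real.sin (x - t) := by
  rw [Real.sin_add, Real.sin_sub]; ring

theorem two_le_of_ne {i j : B} (hij : i ≠ j) (hM : M i j ≠ 0) : 2 ≤ M i j := by
  have := M.off_diagonal i j hij; omega

theorem natCast_mul_angle {i j : B} (hM : M i j ≠ 0) :
    (M i j : ℝ) * (Real.pi / M i j) = Real.pi := by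
  field_simp

theorem sin_angle_pos {i j : B} (hij : i ≠ j) (hM : M i j ≠ 0) :
    0 < Real.sin (Real.pi / M i j) := by
  have h2 : (2 : ℝ) ≤ M i j := by exact_mod_cast two_le_of_ne hij hM
  apply Real.sin_pos_of_pos_of_lt_pi (by positivity)
  rw [div_lt_iff₀ (by positivity)]
  nlinarith [Real.pi_pos]

variable [Fintype B]

/-- The linear form `v ↦ -2 B(eᵢ, v)`. -/
noncomputable def coroot (M : CoxeterMatrix B) (i : B) : (B → ℝ) →ₗ[ℝ] ℝ :=
  ∑ j, cosCoeff M i j • LinearMap.proj j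

theorem coroot_apply (i : B) (v : B → ℝ) : coroot M i v = ∑ j, cosCoeff M i j * v j := by
  simp [coroot]

variable [DecidableEq B]

/-- The reflection in the `i`-th simple root. -/
noncomputable def simpleReflection (M : CoxeterMatrix B) (i : B) : Module.End ℝ (B → ℝ) :=
  LinearMap.id + (coroot M i).smulRight (Pi.single i 1)

theorem simpleReflection_apply (i : B) (v : B → ℝ) :
    simpleReflection M i v = v + coroot M i v • Pi.single i 1 := rfl

theorem coroot_single (i j : B) : coroot M i (Pi.single j 1) = cosCoeff M i j := by
  simp [coroot_apply, Pi.single_apply]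

theorem simpleReflection_simple_self (i : B) :
    simpleReflection M i (Pi.single i 1) = -Pi.single i 1 := by
  rw [simpleReflection_apply, coroot_single, cosCoeff_self]; module

theorem simpleReflection_simple (i j : B) :
    simpleReflection M i (Pi.single j 1) = Pi.single j 1 + cosCoeff M i j • Pi.single i 1 := by
  rw [simpleReflection_apply, coroot_single]

theorem simpleReflection_sq (i : B) : simpleReflection M i * simpleReflection M i = 1 := by
  refine LinearMap.ext fun v ↦ ?_
  rw [Module.End.mul_apply, Module.End.one_apply, simpleReflection_apply i v, map_add, map_smul,
    simpleReflection_simple_self, simpleReflection_apply]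
  module

/-- The product of the two reflections rotates the plane of the two roots by 2t. The factor sin t
avoids a division, and the induction is the recursion sin(x+t) = 2 cos t sin x - sin(x-t), used
twice. -/
theorem sin_smul_simpleReflection_mul_pow_left {i j : B} {t : ℝ}
    (ht : cosCoeff M i j = 2 * Real.cos t) (n : ℕ) :
    Real.sin t • ((simpleReflection M i * simpleReflection M j) ^ n) (Pi.single i 1) =
      Real.sin ((2 * n + 1) * t) • (Pi.single i 1 : B → ℝ) +
        Real.sin (2 * n * t) • (Pi.single j 1 : B → ℝ) := by
  have ht' : cosCoeff M j i = 2 * Real.cos t := by rw [cosCoeff_comm, ht]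
  induction n with
  | zero => simp
  | succ n ih =>
    rw [pow_succ', Module.End.mul_apply, ← map_smul, ih, Module.End.mul_apply]
    simp only [map_add, map_smul, simpleReflection_simple, cosCoeff_self, ht, ht']
    have h1 := two_mul_cos_mul_sin ((2 * n + 1) * t) t
    have h2 := two_mul_cos_mul_sin ((2 * n + 2) * t) t
    have e1 : (2 * (n : ℝ) + 1) * t + t = (2 * n + 2) * t := by ring
    have e2 : (2 * (n : ℝ) + 1) * t - t = 2 * n * t := by ring
    have e3 : (2 * (n : ℝ) + 2) * t + t = (2 * n + 3) * t := by ring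
    have e4 : (2 * (n : ℝ) + 2) * t - t = (2 * n + 1) * t := by ring
    rw [e1, e2] at h1
    rw [e3, e4] at h2
    push_cast
    have e5 : (2 * ((n : ℝ) + 1) + 1) * t = (2 * n + 3) * t := by ring
    have e6 : 2 * ((n : ℝ) + 1) * t = (2 * n + 2) * t := by ring
    rw [e5, e6]
    have h3 : Real.sin ((2 * n + 2) * t) =
      2 * Real.cos t * Real.sin ((2 * n + 1) * t) - Real.sin (2 * n * t) := by linarith
    have h4 : Real.sin ((2 * n + 3) * t) =
      2 * Real.cos t * Real.sin ((2 * n + 2) * t) - Real.sin ((2 * n + 1) * t) := by linarith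
    rw [h4, h3]
    module

theorem simpleReflection_mul_pow_simple {i j : B} (hij : i ≠ j) (hM : M i j ≠ 0) :
    ((simpleReflection M i * simpleReflection M j) ^ M i j) (Pi.single i 1) = Pi.single i 1 := by
  set t := Real.pi / M i j with ht
  have hMt : (M i j : ℝ) * t = Real.pi := natCast_mul_angle hM
  have := sin_smul_simpleReflection_mul_pow_left (M := M) (i := i) (j := j) (t := t) rfl (M i j)
  have e1 : (2 * (M i j : ℝ) + 1) * t = t + 2 * Real.pi := by rw [← hMt]; ring
  have e2 : 2 * (M i j : ℝ) * t = 2 * Real.pi := by rw [← hMt]; ring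
  rw [e1, e2, Real.sin_add_two_pi, Real.sin_two_pi, zero_smul, add_zero] at this
  exact smul_right_injective _ (sin_angle_pos hij hM).ne' this

theorem simpleReflection_mul_pow {i j : B} (hij : i ≠ j) (hM : M i j ≠ 0) :
    (simpleReflection M i * simpleReflection M j) ^ M i j = 1 := by
  set R := simpleReflection M i * simpleReflection M j with hR
  have hi : (R ^ M i j) (Pi.single i 1) = Pi.single i 1 := simpleReflection_mul_pow_simple hij hM
  have hj : (R ^ M i j) (Pi.single j 1) = Pi.single j 1 := by
    have h := simpleReflection_mul_pow_simple hij.symm (M.symmetric i j ▸ hM)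
    rw [M.symmetric j i] at h
    have hinv : R * (simpleReflection M j * simpleReflection M i) = 1 := by
      rw [hR, mul_assoc, ← mul_assoc (simpleReflection M j), simpleReflection_sq, one_mul,
        simpleReflection_sq]
    have hinv' : (simpleReflection M j * simpleReflection M i) * R = 1 := by
      rw [hR, mul_assoc, ← mul_assoc (simpleReflection M i), simpleReflection_sq, one_mul,
        simpleReflection_sq]
    have hc : Commute R (simpleReflection M j * simpleReflection M i) := by
      rw [commute_iff_eq, hinv, hinv']
    calc (R ^ M i j) (Pi.single j 1)
        = (R ^ M i j * (simpleReflection M j * simpleReflection M i) ^ M i j)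
            (Pi.single j 1) := by rw [Module.End.mul_apply, h]
      _ = Pi.single j 1 := by rw [← hc.mul_pow, hinv, one_pow, Module.End.one_apply]
  refine LinearMap.ext fun v ↦ ?_
  set κ := cosCoeff M i j with hκ
  have hs := sin_angle_pos hij hM
  have hD : 4 - κ ^ 2 ≠ 0 := by
    have : 4 - κ ^ 2 = 4 * Real.sin (Real.pi / M i j) ^ 2 := by
      rw [hκ, cosCoeff, Real.sin_sq]; ring
    rw [this]; positivity
  -- These coefficients solve the linear system that makes `w` orthogonal to both roots; its
  -- determinant 4 - κ² does not vanish. So the space is the sum of the plane of the two roots and a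
  -- subspace fixed by both reflections.
  set x := -(2 * coroot M i v + κ * coroot M j v) / (4 - κ ^ 2) with hx
  set y := -(2 * coroot M j v + κ * coroot M i v) / (4 - κ ^ 2) with hy
  obtain ⟨w, hw⟩ : ∃ w, w = v - x • Pi.single i (1 : ℝ) - y • Pi.single j (1 : ℝ) := ⟨_, rfl⟩
  have hwi : coroot M i w = 0 := by
    rw [hw, map_sub, map_sub, map_smul, map_smul, coroot_single, coroot_single, cosCoeff_self,
      ← hκ, hx, hy, smul_eq_mul, smul_eq_mul]
    field_simp
    ring
  have hwj : coroot M j w = 0 := by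
    rw [hw, map_sub, map_sub, map_smul, map_smul, coroot_single, coroot_single, cosCoeff_self,
      cosCoeff_comm j i, ← hκ, hx, hy, smul_eq_mul, smul_eq_mul]
    field_simp
    ring
  have hRw : R w = w := by
    rw [hR, Module.End.mul_apply, simpleReflection_apply j, hwj, zero_smul, add_zero,
      simpleReflection_apply i, hwi, zero_smul, add_zero]
  have hRn : ∀ n, (R ^ n) w = w := fun n ↦ by
    induction n with
    | zero => rfl
    | succ n ih => rw [pow_succ, Module.End.mul_apply, hRw, ih]
  have hv : v = w + x • Pi.single i (1 : ℝ) + y • Pi.single j (1 : ℝ) := by rw [hw]; module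
  rw [hv, map_add, map_add, map_smul, map_smul, hRn, hi, hj, Module.End.one_apply]

theorem isLiftable_simpleReflection (hM : ∀ i j, M i j ≠ 0) :
    M.IsLiftable (simpleReflection M) := fun i j ↦ by
  rcases eq_or_ne i j with rfl | hij
  · rw [M.diagonal, pow_one, simpleReflection_sq]
  · exact simpleReflection_mul_pow hij (hM i j)

variable (cs : CoxeterSystem M W) (hM : ∀ i j, M i j ≠ 0)

/-- The geometric representation. -/
noncomputable def geomRep : W →* Module.End ℝ (B → ℝ) :=
  cs.lift ⟨simpleReflection M, isLiftable_simpleReflection hM⟩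

theorem geomRep_simple (i : B) : cs.geomRep hM (cs.simple i) = simpleReflection M i :=
  cs.lift_apply_simple _ i

theorem geomRep_mul_simple (g : W) (i : B) (v : B → ℝ) :
    cs.geomRep hM (g * cs.simple i) v = cs.geomRep hM g (simpleReflection M i v) := by
  rw [map_mul, geomRep_simple, Module.End.mul_apply]

theorem geomRep_mul_simple_self (g : W) (i : B) :
    cs.geomRep hM (g * cs.simple i) (Pi.single i 1) = -cs.geomRep hM g (Pi.single i 1) := by
  rw [geomRep_mul_simple, simpleReflection_simple_self, map_neg]

end Geometric
-- Alternating words and factorization along rank-two cosets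
section Alternating

/-- The `n`-th letter of the alternating word `i j i j ⋯`. -/
def altLetter (i j : B) (n : ℕ) : B := if Even n then i else j

@[simp] theorem altLetter_zero (i j : B) : altLetter i j 0 = i := rfl

theorem altLetter_succ (i j : B) (n : ℕ) : altLetter i j (n + 1) = altLetter j i n := by
  unfold altLetter; grind

theorem altLetter_eq_or (i j : B) (n : ℕ) : altLetter i j n = i ∨ altLetter i j n = j := by
  unfold altLetter; grind

theorem altLetter_eq_of_ne_succ {i j a : B} (ha : a = i ∨ a = j) {n : ℕ}
    (h : altLetter i j n ≠ a) : altLetter i j (n + 1) = a := by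
  unfold altLetter at *; grind

variable (cs : CoxeterSystem M W)

/-- The product `sᵢ sⱼ sᵢ ⋯` with `n` factors. -/
def altProd (i j : B) : ℕ → W
  | 0 => 1
  | n + 1 => altProd i j n * cs.simple (altLetter i j n)

@[simp] theorem altProd_zero (i j : B) : cs.altProd i j 0 = 1 := rfl

theorem altProd_succ (i j : B) (n : ℕ) :
    cs.altProd i j (n + 1) = cs.altProd i j n * cs.simple (altLetter i j n) := rfl

theorem altProd_one (i j : B) : cs.altProd i j 1 = cs.simple i := by simp [altProd_succ]

theorem inv_altProd (i j : B) (n : ℕ) :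
    (cs.altProd i j n)⁻¹ = cs.wordProd (alternatingWord j i n) := by
  induction n with
  | zero => simp [alternatingWord]
  | succ n ih =>
    rw [altProd_succ, mul_inv_rev, ih, inv_simple, alternatingWord_succ', wordProd_cons, altLetter]

theorem altProd_braid (i j : B) : cs.altProd i j (M i j) = cs.altProd j i (M i j) := by
  rw [← inv_inj, inv_altProd, inv_altProd]
  have := cs.wordProd_braidWord_eq i j
  rw [braidWord, braidWord, M.symmetric j i] at this
  exact this.symm

theorem length_altProd_le (i j : B) (n : ℕ) : cs.length (cs.altProd i j n) ≤ n := by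
  induction n with
  | zero => simp
  | succ n ih =>
    have := cs.length_mul_le (cs.altProd i j n) (cs.simple (altLetter i j n))
    rw [length_simple] at this
    rw [altProd_succ]; omega

/-- The braid relation applied to the first `M i j` letters makes the last of them equal to the
letter that follows, and the two cancel. Each later letter adds at most one. -/
theorem length_altProd_succ_lt {i j : B} (hM : M i j ≠ 0) {n : ℕ} (hn : M i j ≤ n) :
    cs.length (cs.altProd i j (n + 1)) < n := by
  induction n, hn using Nat.le_induction with
  | base =>
    obtain ⟨k, hk⟩ := Nat.exists_eq_succ_of_ne_zero hM
    rw [altProd_succ, altProd_braid, hk, Nat.succ_eq_add_one, altLetter_succ, altProd_succ,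
      simple_mul_simple_cancel_right]
    have := cs.length_altProd_le j i k
    omega
  | succ n hn ih =>
    have := cs.length_mul_le (cs.altProd i j (n + 1)) (cs.simple (altLetter i j (n + 1)))
    rw [length_simple] at this
    rw [altProd_succ]; omega

/-- Every element is the reduced product of an element with no right descent among `i`, `j` and of
an alternating word in `sᵢ`, `sⱼ`. -/
theorem exists_eq_mul_altProd (g : W) (i j : B) :
    ∃ (x : W) (p q : B) (n : ℕ), (p = i ∧ q = j ∨ p = j ∧ q = i) ∧ g = x * cs.altProd p q n ∧
      cs.length g = cs.length x + n ∧ ¬cs.IsRightDescent x i ∧ ¬cs.IsRightDescent x j := by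
  induction hl : cs.length g using Nat.strong_induction_on generalizing g with
  | _ l ih =>
  by_cases h : cs.IsRightDescent g i ∨ cs.IsRightDescent g j
  · obtain ⟨a, ha, hd⟩ : ∃ a, (a = i ∨ a = j) ∧ cs.IsRightDescent g a := by
      rcases h with h | h
      exacts [⟨i, .inl rfl, h⟩, ⟨j, .inr rfl, h⟩]
    have hlen := cs.isRightDescent_iff.mp hd
    obtain ⟨x, p, q, n, hpq, hg, hn, hi, hj⟩ := ih _ (by omega) (g * cs.simple a) rfl
    have hg' : g = g * cs.simple a * cs.simple a := by simp
    rcases n with _ | n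
    · have hx : g = x * cs.simple a := by rw [hg', hg]; simp
      obtain ⟨b, hb⟩ : ∃ b, a = i ∧ b = j ∨ a = j ∧ b = i := by
        rcases ha with rfl | rfl
        exacts [⟨j, .inl ⟨rfl, rfl⟩⟩, ⟨i, .inr ⟨rfl, rfl⟩⟩]
      exact ⟨x, a, b, 1, hb, by rw [altProd_one, hx], by omega, hi, hj⟩
    · have hapq : a = p ∨ a = q := by grind
      have hne : altLetter p q n ≠ a := fun hna ↦ by
        have : g = x * cs.altProd p q n := by
          rw [hg', hg, altProd_succ, hna, ← mul_assoc, simple_mul_simple_cancel_right]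
        have h1 := cs.length_mul_le x (cs.altProd p q n)
        have h2 := cs.length_altProd_le p q n
        rw [← this] at h1
        omega
      refine ⟨x, p, q, n + 2, hpq, ?_, by omega, hi, hj⟩
      rw [altProd_succ, altLetter_eq_of_ne_succ hapq hne, ← mul_assoc, ← hg, ← hg']
  · push Not at h
    exact ⟨g, i, j, 0, .inl ⟨rfl, rfl⟩, by simp, by omega, h.1, h.2⟩

end Alternating

/-! ### The invariant bilinear form -/

section Form

variable [Fintype B]

/-- Minus twice the canonical bilinear form. -/
noncomputable def cosForm (M : CoxeterMatrix B) (v w : B → ℝ) : ℝ := ∑ i, v i * coroot M i w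

theorem cosForm_comm (v w : B → ℝ) : cosForm M v w = cosForm M w v := by
  simp only [cosForm, coroot_apply, Finset.mul_sum]
  rw [Finset.sum_comm]
  refine Finset.sum_congr rfl fun i _ ↦ Finset.sum_congr rfl fun j _ ↦ ?_
  rw [cosCoeff_comm]; ring

theorem cosForm_add_smul_left (u v w : B → ℝ) (c : ℝ) :
    cosForm M (u + c • v) w = cosForm M u w + c * cosForm M v w := by
  simp only [cosForm, Pi.add_apply, Pi.smul_apply, smul_eq_mul, add_mul, Finset.sum_add_distrib,
    Finset.mul_sum, mul_assoc]

theorem cosForm_add_smul_right (u v w : B → ℝ) (c : ℝ) :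
    cosForm M w (u + c • v) = cosForm M w u + c * cosForm M w v := by
  rw [cosForm_comm, cosForm_add_smul_left, cosForm_comm u, cosForm_comm v]

end Form

/-! ### Roots, their signs, and descents -/

section Geometric

variable [Fintype B] [DecidableEq B] (cs : CoxeterSystem M W) (hM : ∀ i j, M i j ≠ 0)

/-- The prefixes of an alternating word, applied to the next letter's root, list the roots of the
dihedral subsystem in angular order. Both coefficients are nonnegative as long as n < `M i j`. -/
theorem sin_smul_geomRep_altProd (i j : B) (n : ℕ) :
    Real.sin (Real.pi / M i j) •
        cs.geomRep hM (cs.altProd i j n) (Pi.single (altLetter i j n) 1) =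
      Real.sin ((n + 1) * (Real.pi / M i j)) • (Pi.single i 1 : B → ℝ) +
        Real.sin (n * (Real.pi / M i j)) • (Pi.single j 1 : B → ℝ) := by
  set t := Real.pi / M i j with ht
  have hκ : cosCoeff M i j = 2 * Real.cos t := rfl
  have hκ' : cosCoeff M j i = 2 * Real.cos t := by rw [cosCoeff_comm, hκ]
  have hl : ∀ n, cosCoeff M (altLetter i j n) (altLetter i j (n + 1)) = 2 * Real.cos t := by
    intro n
    rcases Nat.even_or_odd n with h | h
    · simp [altLetter, h, Nat.even_add_one, hκ]
    · simp [altLetter, Nat.not_even_iff_odd.mpr h, Nat.even_add_one, hκ']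
  induction n using Nat.twoStepInduction with
  | zero => simp
  | one =>
    rw [altProd_one, geomRep_simple, altLetter_succ, altLetter_zero, simpleReflection_simple, hκ]
    have h := two_mul_cos_mul_sin t t
    rw [sub_self, Real.sin_zero, add_zero] at h
    have e : ((1 : ℕ) + 1 : ℝ) * t = t + t := by push_cast; ring
    rw [e, ← h]
    push_cast
    rw [one_mul]
    module
  | more n ih1 ih2 =>
    have e1 : altLetter i j (n + 2) = altLetter i j n := by rw [altLetter_succ, altLetter_succ]
    have e2 : cosCoeff M (altLetter i j (n + 1)) (altLetter i j n) = 2 * Real.cos t := by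
      rw [cosCoeff_comm, hl]
    rw [altProd_succ, e1, geomRep_mul_simple, simpleReflection_simple, e2, map_add, map_smul,
      smul_add, smul_comm, ih2]
    conv_lhs =>
      rw [altProd_succ, geomRep_mul_simple_self, smul_neg, ih1]
    have h1 := two_mul_cos_mul_sin ((n + 1) * t) t
    have h2 := two_mul_cos_mul_sin ((n + 2) * t) t
    have a1 : ((n : ℝ) + 1) * t + t = (n + 2) * t := by ring
    have a2 : ((n : ℝ) + 1) * t - t = n * t := by ring
    have a3 : ((n : ℝ) + 2) * t + t = (n + 3) * t := by ring
    have a4 : ((n : ℝ) + 2) * t - t = (n + 1) * t := by ring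
    rw [a1, a2] at h1
    rw [a3, a4] at h2
    have h1' : Real.sin ((n + 2) * t) =
      2 * Real.cos t * Real.sin ((n + 1) * t) - Real.sin (n * t) := by linarith
    have h2' : Real.sin ((n + 3) * t) =
      2 * Real.cos t * Real.sin ((n + 2) * t) - Real.sin ((n + 1) * t) := by linarith
    have b1 : (((n + 2 : ℕ) : ℝ) + 1) * t = (n + 3) * t := by push_cast; ring
    have b2 : ((n + 2 : ℕ) : ℝ) * t = (n + 2) * t := by push_cast; ring
    have b3 : (((n + 1 : ℕ) : ℝ) + 1) * t = (n + 2) * t := by push_cast; ring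
    have b4 : ((n + 1 : ℕ) : ℝ) * t = (n + 1) * t := by push_cast; ring
    rw [b1, b2, b3, b4, h2', h1']
    module

/-- If `x` maps the simple roots `i`, `j` to positive roots, then so does `x * altProd i j n` for
the next letter. -/
theorem geomRep_mul_altProd_nonneg {x : W} {i j : B} (hij : i ≠ j)
    (hi : 0 ≤ cs.geomRep hM x (Pi.single i 1)) (hj : 0 ≤ cs.geomRep hM x (Pi.single j 1))
    {n : ℕ} (hn : n < M i j) :
    0 ≤ cs.geomRep hM (x * cs.altProd i j n) (Pi.single (altLetter i j n) 1) := by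
  have hs := sin_angle_pos hij (hM i j)
  have hMt := natCast_mul_angle (hM i j)
  have ht : 0 < Real.pi / M i j := by have := hM i j; positivity
  have key : ∀ k : ℕ, k ≤ M i j → 0 ≤ Real.sin (k * (Real.pi / M i j)) := fun k hk ↦ by
    apply Real.sin_nonneg_of_nonneg_of_le_pi (by positivity)
    rw [← hMt]
    gcongr
    rw [hMt]
  suffices h : 0 ≤ Real.sin (Real.pi / M i j) •
      cs.geomRep hM (x * cs.altProd i j n) (Pi.single (altLetter i j n) 1) by
    have h' := smul_nonneg (inv_nonneg.mpr hs.le) h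
    rwa [inv_smul_smul₀ hs.ne'] at h'
  rw [map_mul, Module.End.mul_apply, ← map_smul,
    sin_smul_geomRep_altProd, map_add, map_smul, map_smul]
  have h1 := key (n + 1) hn
  push_cast at h1
  exact add_nonneg (smul_nonneg h1 hi) (smul_nonneg (key n hn.le) hj)

/-- A simple reflection which does not shorten `g` corresponds to a simple root that `g` maps to a
positive root. -/
theorem geomRep_nonneg_of_not_isRightDescent {g : W} {i : B} (h : ¬cs.IsRightDescent g i) :
    0 ≤ cs.geomRep hM g (Pi.single i 1) := by
  induction hl : cs.length g using Nat.strong_induction_on generalizing g i with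
  | _ l ih =>
  by_cases hg : g = 1
  · rw [hg, map_one, Module.End.one_apply, Pi.single_nonneg]
    exact zero_le_one
  obtain ⟨j, hj⟩ := cs.exists_rightDescent_of_ne_one hg
  have hij : i ≠ j := fun e ↦ h (e ▸ hj)
  -- Since `j` is a descent of `g`, the alternating part is nonempty. So `x` is shorter than `g`,
  -- and the induction hypothesis applies to it with both letters.
  obtain ⟨x, p, q, n, hpq, hx, hn, hi', hj'⟩ := cs.exists_eq_mul_altProd g i j
  have hpq' : p ≠ q := by grind
  have hp : ¬cs.IsRightDescent x p := by grind
  have hq : ¬cs.IsRightDescent x q := by grind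
  rcases n with _ | n
  · simp only [altProd_zero, mul_one] at hx
    exact absurd (hx ▸ hj) hj'
  have hlast : altLetter p q n ≠ i := fun hni ↦ by
    apply h
    rw [IsRightDescent, hx, altProd_succ, hni, ← mul_assoc, simple_mul_simple_cancel_right]
    rw [← hni, mul_assoc, ← altProd_succ, ← hx]
    have h1 := cs.length_mul_le x (cs.altProd p q n)
    have h2 := cs.length_altProd_le p q n
    omega
  have hnext : altLetter p q (n + 1) = i := altLetter_eq_of_ne_succ (by grind) hlast
  -- Otherwise the alternating word extended by `i` would have dropped in length, and `i` would be a
  -- descent of `g`.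
  have hlt : n + 1 < M p q := by
    by_contra! hge
    have h1 := cs.length_altProd_succ_lt (hM p q) hge
    have h2 := cs.length_mul_le x (cs.altProd p q (n + 1 + 1))
    rw [altProd_succ, hnext, ← mul_assoc, ← hx] at h2
    rw [altProd_succ, hnext] at h1
    have h3 := cs.not_isRightDescent_iff.mp h
    omega
  have := cs.geomRep_mul_altProd_nonneg hM hpq' (ih _ (by omega) hp rfl) (ih _ (by omega) hq rfl)
    hlt
  rwa [hnext, ← hx] at this

theorem geomRep_nonpos_of_isRightDescent {g : W} {i : B} (h : cs.IsRightDescent g i) :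
    cs.geomRep hM g (Pi.single i 1) ≤ 0 := by
  have := cs.geomRep_nonneg_of_not_isRightDescent hM
    ((cs.isRightDescent_iff_not_isRightDescent_mul).mp h)
  rw [geomRep_mul_simple_self] at this
  exact neg_nonneg.mp this

theorem geomRep_single_ne_zero (g : W) (i : B) : cs.geomRep hM g (Pi.single i 1) ≠ 0 := by
  intro h
  have h2 : cs.geomRep hM (g⁻¹ * g) (Pi.single i 1) = 0 := by
    rw [map_mul, Module.End.mul_apply, h, map_zero]
  rw [inv_mul_cancel, map_one, Module.End.one_apply] at h2
  simpa using congrFun h2 i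

theorem not_isRightDescent_of_geomRep_nonneg {g : W} {i : B}
    (h : 0 ≤ cs.geomRep hM g (Pi.single i 1)) : ¬cs.IsRightDescent g i := fun hd ↦
  cs.geomRep_single_ne_zero hM g i
    (le_antisymm (cs.geomRep_nonpos_of_isRightDescent hM hd) h)

theorem isRightDescent_of_geomRep_nonpos {g : W} {i : B}
    (h : cs.geomRep hM g (Pi.single i 1) ≤ 0) : cs.IsRightDescent g i := by
  by_contra hd
  exact cs.geomRep_single_ne_zero hM g i
    (le_antisymm h (cs.geomRep_nonneg_of_not_isRightDescent hM hd))

theorem not_isRightDescent_mul_altProd (hM : ∀ i j, M i j ≠ 0) {x : W} {i j : B} (hij : i ≠ j)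
    (hi : ¬cs.IsRightDescent x i) (hj : ¬cs.IsRightDescent x j) {n : ℕ} (hn : n < M i j) :
    ¬cs.IsRightDescent (x * cs.altProd i j n) (altLetter i j n) := by
  exact cs.not_isRightDescent_of_geomRep_nonneg hM (cs.geomRep_mul_altProd_nonneg hM hij
    (cs.geomRep_nonneg_of_not_isRightDescent hM hi)
    (cs.geomRep_nonneg_of_not_isRightDescent hM hj) hn)

theorem cosForm_single_left (i : B) (w : B → ℝ) :
    cosForm M (Pi.single i 1) w = coroot M i w := by
  simp [cosForm, Pi.single_apply]

theorem cosForm_single_self (i : B) : cosForm M (Pi.single i 1) (Pi.single i 1) = -2 := by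
  rw [cosForm_single_left, coroot_single, cosCoeff_self]

theorem cosForm_simpleReflection (i : B) (v w : B → ℝ) :
    cosForm M (simpleReflection M i v) (simpleReflection M i w) = cosForm M v w := by
  rw [simpleReflection_apply, simpleReflection_apply, cosForm_add_smul_left,
    cosForm_add_smul_right, cosForm_add_smul_right, cosForm_single_self, cosForm_single_left,
    cosForm_comm v (Pi.single i 1), cosForm_single_left]
  ring

theorem cosForm_geomRep (g : W) (v w : B → ℝ) :
    cosForm M (cs.geomRep hM g v) (cs.geomRep hM g w) = cosForm M v w := by
  induction g using cs.simple_induction_right generalizing v w with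
  | one => simp
  | mul_simple_right g i ih => rw [geomRep_mul_simple, geomRep_mul_simple, ih, cosForm_simpleReflection]

/-- The real roots of the geometric representation. -/
def IsRealRoot (β : B → ℝ) : Prop := ∃ g i, β = cs.geomRep hM g (Pi.single i 1)

variable {cs hM}

theorem IsRealRoot.nonneg_or_nonpos {β : B → ℝ} (hβ : cs.IsRealRoot hM β) : 0 ≤ β ∨ β ≤ 0 := by
  obtain ⟨g, i, rfl⟩ := hβ
  by_cases h : cs.IsRightDescent g i
  · exact .inr (cs.geomRep_nonpos_of_isRightDescent hM h)
  · exact .inl (cs.geomRep_nonneg_of_not_isRightDescent hM h)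

theorem IsRealRoot.simpleReflection {β : B → ℝ} (hβ : cs.IsRealRoot hM β) (a : B) :
    cs.IsRealRoot hM (simpleReflection M a β) := by
  obtain ⟨g, i, rfl⟩ := hβ
  exact ⟨cs.simple a * g, i, by rw [map_mul, geomRep_simple, Module.End.mul_apply]⟩

theorem IsRealRoot.cosForm_self {β : B → ℝ} (hβ : cs.IsRealRoot hM β) : cosForm M β β = -2 := by
  obtain ⟨g, i, rfl⟩ := hβ
  rw [cosForm_geomRep, cosForm_single_self]

theorem isRealRoot_single (i : B) : cs.IsRealRoot hM (Pi.single i 1) := ⟨1, i, by simp⟩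

/-- A simple reflection permutes the positive roots other than its simple root. -/
theorem IsRealRoot.simpleReflection_nonneg_or {β : B → ℝ} (hβ : cs.IsRealRoot hM β) (h0 : 0 ≤ β)
    (a : B) : 0 ≤ CoxeterSystem.simpleReflection M a β ∨ β = Pi.single a 1 := by
  refine (hβ.simpleReflection a).nonneg_or_nonpos.imp id fun hneg ↦ ?_
  -- The reflection changes only the coordinate `a`, so a sign change of the whole root forces all
  -- others to vanish. The form value -2 then fixes the multiple of the simple root to be 1.
  have hk : ∀ k ≠ a, β k = 0 := fun k hk ↦ by
    have := hneg k
    rw [simpleReflection_apply, Pi.add_apply, Pi.smul_apply, Pi.single_eq_of_ne hk, smul_zero,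
      add_zero] at this
    exact le_antisymm this (h0 k)
  have hβa : β = β a • Pi.single a (1 : ℝ) := by
    ext k
    rcases eq_or_ne k a with rfl | hka
    · simp
    · simp [hk k hka, hka]
  have hsq := hβ.cosForm_self
  have h0' : β = 0 + β a • Pi.single a (1 : ℝ) := by rw [zero_add, ← hβa]
  have hz : ∀ w : B → ℝ, cosForm M 0 w = 0 := fun w ↦ by simp [cosForm]
  rw [h0', cosForm_add_smul_left, hz, cosForm_add_smul_right, cosForm_comm _ 0, hz,
    cosForm_single_self] at hsq
  have h1 : β a = 1 := by
    have := h0 a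
    simp only [Pi.zero_apply] at this
    simp at hsq
    nlinarith
  rw [hβa, h1, one_smul]

/-- Two positive roots that span an infinite dihedral reflection group, and form an obtuse angle,
are not both mapped to negative roots by any group element. -/
theorem IsRealRoot.not_nonpos_of_two_le_cosForm {β γ : B → ℝ} (hβ : cs.IsRealRoot hM β)
    (hγ : cs.IsRealRoot hM γ) (hβ0 : 0 ≤ β) (hγ0 : 0 ≤ γ) (h : 2 ≤ cosForm M β γ) (g : W)
    (hgβ : cs.geomRep hM g β ≤ 0) : ¬cs.geomRep hM g γ ≤ 0 := by
  intro hgγ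
  induction hl : cs.length g using Nat.strong_induction_on generalizing g β γ with
  | _ l ih =>
  by_cases hg : g = 1
  · subst hg
    rw [map_one, Module.End.one_apply] at hgβ
    have : β = 0 := le_antisymm hgβ hβ0
    simp [this, cosForm] at h
    linarith
  obtain ⟨a, ha⟩ := cs.exists_rightDescent_of_ne_one hg
  have hlen := cs.isRightDescent_iff.mp ha
  have hga : 0 ≤ cs.geomRep hM (g * cs.simple a) (Pi.single a 1) :=
    cs.geomRep_nonneg_of_not_isRightDescent hM
      (cs.isRightDescent_iff_not_isRightDescent_mul.mp ha)
  have hstep : ∀ v, cs.geomRep hM (g * cs.simple a) (CoxeterSystem.simpleReflection M a v) =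
      cs.geomRep hM g v := fun v ↦ by
    rw [← geomRep_mul_simple, simple_mul_simple_cancel_right]
  -- If one of the two roots is the simple root α_a, reflecting would make it negative. The pair
  -- (α_a, δ) is traded instead for (δ, s_a δ): with c = `coroot M a δ`, its form value is c² - 2 ≥
  -- 2, and the shorter element `g * cs.simple a` still makes both negative.
  have key : ∀ δ : B → ℝ, cs.IsRealRoot hM δ → 0 ≤ δ → 2 ≤ coroot M a δ →
      ¬cs.geomRep hM g δ ≤ 0 := by
    intro δ hδ hδ0 hc hgδ
    rcases hδ.simpleReflection_nonneg_or hδ0 a with hs | rfl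
    · refine ih (cs.length (g * cs.simple a)) (by omega) hδ (hδ.simpleReflection a) hδ0 hs ?_ _
        ?_ ?_ rfl
      · rw [simpleReflection_apply, cosForm_add_smul_right, hδ.cosForm_self, cosForm_comm,
          cosForm_single_left]
        nlinarith
      · have e := hstep δ
        rw [simpleReflection_apply, map_add, map_smul] at e
        rw [eq_sub_of_add_eq e, sub_nonpos]
        exact hgδ.trans (smul_nonneg (by linarith) hga)
      · rw [hstep]; exact hgδ
    · rw [coroot_single, cosCoeff_self] at hc
      linarith
  rcases hβ.simpleReflection_nonneg_or hβ0 a with hsβ | rfl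
  · rcases hγ.simpleReflection_nonneg_or hγ0 a with hsγ | rfl
    · exact ih (cs.length (g * cs.simple a)) (by omega) (hβ.simpleReflection a)
        (hγ.simpleReflection a) hsβ hsγ (by rwa [cosForm_simpleReflection]) _
        (by rwa [hstep]) (by rwa [hstep]) rfl
    · rw [cosForm_comm, cosForm_single_left] at h
      exact key β hβ hβ0 h hgβ
  · rw [cosForm_single_left] at h
    exact key γ hγ hγ0 h hgγ

end Geometric
-- Rank-two residues and potentials on the weak order
section Residue

variable [Fintype B] [DecidableEq B] (cs : CoxeterSystem M W) (hM : ∀ i j, M i j ≠ 0)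

include hM in
theorem length_mul_altProd {x : W} {i j : B} (hij : i ≠ j)
    (hi : ¬cs.IsRightDescent x i) (hj : ¬cs.IsRightDescent x j) {n : ℕ} (hn : n ≤ M i j) :
    cs.length (x * cs.altProd i j n) = cs.length x + n := by
  induction n with
  | zero => simp
  | succ n ih =>
    rw [altProd_succ, ← mul_assoc, cs.not_isRightDescent_iff.mp
      (cs.not_isRightDescent_mul_altProd hM hij hi hj hn), ih (by omega), add_assoc]

include hM in
theorem isRightDescent_mul_altProd {x : W} {i j : B} (hij : i ≠ j)
    (hi : ¬cs.IsRightDescent x i) (hj : ¬cs.IsRightDescent x j) {n : ℕ} (hn : n < M i j) :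
    cs.IsRightDescent (x * cs.altProd i j (n + 1)) (altLetter i j n) := by
  rw [altProd_succ, ← mul_assoc, isRightDescent_iff_not_isRightDescent_mul,
    simple_mul_simple_cancel_right]
  exact cs.not_isRightDescent_mul_altProd hM hij hi hj hn

omit [Fintype B] [DecidableEq B] in
include hM in
theorem exists_eq_mul_altProd_le (g : W) {i j : B} (hij : i ≠ j) :
    ∃ (x : W) (p q : B) (n : ℕ), (p = i ∧ q = j ∨ p = j ∧ q = i) ∧ g = x * cs.altProd p q n ∧
      cs.length g = cs.length x + n ∧ n ≤ M i j ∧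
        ¬cs.IsRightDescent x i ∧ ¬cs.IsRightDescent x j := by
  obtain ⟨x, p, q, n, hpq, hg, hn, hi, hj⟩ := cs.exists_eq_mul_altProd g i j
  refine ⟨x, p, q, n, hpq, hg, hn, ?_, hi, hj⟩
  by_contra! h
  obtain ⟨k, rfl⟩ := Nat.exists_eq_succ_of_ne_zero (Nat.ne_zero_of_lt h)
  have hMpq : M p q = M i j := by
    rcases hpq with ⟨rfl, rfl⟩ | ⟨rfl, rfl⟩
    exacts [rfl, M.symmetric _ _]
  have h1 := cs.length_altProd_succ_lt (hM p q) (n := k) (by omega)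
  have h2 := cs.length_mul_le x (cs.altProd p q (k + 1))
  rw [← hg] at h2
  have h3 : k.succ = k + 1 := rfl
  omega

include hM in
theorem exists_eq_mul_altProd_of_isRightDescent {g : W} {i j : B} (hij : i ≠ j)
    (hi : cs.IsRightDescent g i) (hj : cs.IsRightDescent g j) :
    ∃ x : W, g = x * cs.altProd i j (M i j) ∧
      ¬cs.IsRightDescent x i ∧ ¬cs.IsRightDescent x j := by
  obtain ⟨x, p, q, n, hpq, hg, hn, hnM, hi', hj'⟩ := cs.exists_eq_mul_altProd_le hM g hij
  have hn' : n = M i j := by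
    refine hnM.antisymm (not_lt.mp fun hlt ↦ ?_)
    have hMpq : M p q = M i j := by
      rcases hpq with ⟨rfl, rfl⟩ | ⟨rfl, rfl⟩
      exacts [rfl, M.symmetric _ _]
    have := cs.not_isRightDescent_mul_altProd hM (x := x) (i := p) (j := q) (n := n)
      (by grind) (by grind) (by grind) (by omega)
    rw [← hg] at this
    rcases altLetter_eq_or p q n with h | h <;> grind
  refine ⟨x, ?_, hi', hj'⟩
  rcases hpq with ⟨rfl, rfl⟩ | ⟨rfl, rfl⟩
  · rw [hg, hn']
  · rw [hg, hn', altProd_braid]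

/-- The function on the Coxeter group whose increments along the weak order are given by `c`, computed
along a chosen chain. -/
noncomputable def potential (c : W → B → ℕ) (g : W) : ℕ :=
  open Classical in
  if h : g = 1 then 0 else
    potential c (g * cs.simple (cs.exists_rightDescent_of_ne_one h).choose) +
      c (g * cs.simple (cs.exists_rightDescent_of_ne_one h).choose)
        (cs.exists_rightDescent_of_ne_one h).choose
termination_by cs.length g
decreasing_by exact (cs.exists_rightDescent_of_ne_one h).choose_spec

omit [Fintype B] [DecidableEq B] in
theorem potential_one (c : W → B → ℕ) : cs.potential c 1 = 0 := by
  rw [potential]; simp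

include hM in
/-- Increments along the weak order which are consistent on each residue of rank two come from a
function on the group. -/
theorem potential_mul_simple {c : W → B → ℕ}
    (hc : ∀ x i j, i ≠ j → ¬cs.IsRightDescent x i → ¬cs.IsRightDescent x j →
      ∑ k ∈ Finset.range (M i j), c (x * cs.altProd i j k) (altLetter i j k) =
        ∑ k ∈ Finset.range (M i j), c (x * cs.altProd j i k) (altLetter j i k))
    {g : W} {i : B} (h : ¬cs.IsRightDescent g i) :
    cs.potential c (g * cs.simple i) = cs.potential c g + c g i := by
  suffices H : ∀ g i, cs.IsRightDescent g i →
      cs.potential c g = cs.potential c (g * cs.simple i) + c (g * cs.simple i) i by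
    have := H (g * cs.simple i) i (by
      rw [isRightDescent_iff_not_isRightDescent_mul, simple_mul_simple_cancel_right]; exact h)
    rwa [simple_mul_simple_cancel_right] at this
  clear h
  intro g
  induction hl : cs.length g using Nat.strong_induction_on generalizing g with
  | _ l ih =>
  intro i hi
  have hg : g ≠ 1 := by rintro rfl; exact cs.not_isRightDescent_one i hi
  set t := (cs.exists_rightDescent_of_ne_one hg).choose with ht
  have htd : cs.IsRightDescent g t := (cs.exists_rightDescent_of_ne_one hg).choose_spec
  have hgt : cs.potential c g =
      cs.potential c (g * cs.simple t) + c (g * cs.simple t) t := by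
    rw [potential, dif_neg hg]
  rcases eq_or_ne t i with hti | hti
  · rw [hgt, hti]
  obtain ⟨x, hx, hxt, hxi⟩ := cs.exists_eq_mul_altProd_of_isRightDescent hM hti htd hi
  have hlen : ∀ p q, p = t ∧ q = i ∨ p = i ∧ q = t → ∀ n ≤ M t i,
      cs.length (x * cs.altProd p q n) = cs.length x + n := by
    rintro p q (⟨rfl, rfl⟩ | ⟨rfl, rfl⟩) n hn
    · exact cs.length_mul_altProd hM hti hxt hxi hn
    · exact cs.length_mul_altProd hM hti.symm hxi hxt (by rwa [M.symmetric])
  have hgl : cs.length g = cs.length x + M t i := by rw [hx, hlen t i (by simp) _ le_rfl]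
  -- Strictly below `g` the induction hypothesis gives the increments along both sides of the
  -- residue. The final step up to `g` is what is being proved, so `fin` only adds its increment to
  -- the sum.
  have path : ∀ p q, p = t ∧ q = i ∨ p = i ∧ q = t → ∀ n < M t i,
      cs.potential c (x * cs.altProd p q n) = cs.potential c x +
        ∑ k ∈ Finset.range n, c (x * cs.altProd p q k) (altLetter p q k) := by
    intro p q hpq n hn
    induction n with
    | zero => simp
    | succ n ihn =>
      have hd : x * cs.altProd p q (n + 1) * cs.simple (altLetter p q n) =
          x * cs.altProd p q n := by
        rw [altProd_succ, ← mul_assoc, simple_mul_simple_cancel_right]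
      have h1 := ih (cs.length (x * cs.altProd p q (n + 1)))
        (by rw [hlen p q hpq _ hn.le]; omega) (x * cs.altProd p q (n + 1)) rfl (altLetter p q n)
        (by rw [IsRightDescent, hd, hlen p q hpq _ hn.le, hlen p q hpq _ (by omega)]; omega)
      rw [h1, hd, ihn (by omega), Finset.sum_range_succ, add_assoc]
  obtain ⟨N, hN⟩ := Nat.exists_eq_succ_of_ne_zero (hM t i)
  have fin : ∀ p q, p = t ∧ q = i ∨ p = i ∧ q = t →
      cs.potential c (g * cs.simple (altLetter p q N)) +
        c (g * cs.simple (altLetter p q N)) (altLetter p q N) = cs.potential c x +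
        ∑ k ∈ Finset.range (M t i), c (x * cs.altProd p q k) (altLetter p q k) := by
    intro p q hpq
    have hgp : g = x * cs.altProd p q (N + 1) := by
      rw [hx, hN]
      rcases hpq with ⟨rfl, rfl⟩ | ⟨rfl, rfl⟩
      · rfl
      · rw [← Nat.succ_eq_add_one, ← hN, altProd_braid]
    have : g * cs.simple (altLetter p q N) = x * cs.altProd p q N := by
      rw [hgp, altProd_succ, ← mul_assoc, simple_mul_simple_cancel_right]
    rw [this, path p q hpq N (by omega), hN, Finset.sum_range_succ, add_assoc]
  have h1 := fin t i (by simp)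
  have h2 := fin i t (by simp)
  rw [hc x t i hti hxt hxi, ← h2] at h1
  rw [hgt]
  -- The parity of N = `M t i` - 1 decides which of the two paths ends with `t`.
  rcases Nat.even_or_odd N with hev | hod
  · simpa [altLetter, hev] using h1
  · simpa [altLetter, Nat.not_even_iff_odd.mpr hod] using h1.symm

include hM in
theorem potential_mul_altProd {c : W → B → ℕ}
    (hc : ∀ x i j, i ≠ j → ¬cs.IsRightDescent x i → ¬cs.IsRightDescent x j →
      ∑ k ∈ Finset.range (M i j), c (x * cs.altProd i j k) (altLetter i j k) =
        ∑ k ∈ Finset.range (M i j), c (x * cs.altProd j i k) (altLetter j i k))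
    {x : W} {i j : B} (hij : i ≠ j) (hi : ¬cs.IsRightDescent x i) (hj : ¬cs.IsRightDescent x j)
    {n : ℕ} (hn : n ≤ M i j) :
    cs.potential c (x * cs.altProd i j n) =
      cs.potential c x + ∑ k ∈ Finset.range n, c (x * cs.altProd i j k) (altLetter i j k) := by
  induction n with
  | zero => simp
  | succ n ih =>
    rw [altProd_succ, ← mul_assoc, cs.potential_mul_simple hM hc
      (cs.not_isRightDescent_mul_altProd hM hij hi hj hn), ih (by omega), Finset.sum_range_succ,
      add_assoc]

omit [Fintype B] [DecidableEq B] in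
theorem altProd_mem_closure (i j : B) (n : ℕ) :
    cs.altProd i j n ∈ Subgroup.closure {cs.simple i, cs.simple j} := by
  induction n with
  | zero => exact one_mem _
  | succ n ih =>
    refine mul_mem ih (Subgroup.subset_closure ?_)
    rcases altLetter_eq_or i j n with h | h <;> simp [h]

omit [Fintype B] [DecidableEq B] in
theorem altProd_mem_closure' (i j : B) (n : ℕ) :
    cs.altProd j i n ∈ Subgroup.closure {cs.simple i, cs.simple j} := by
  rw [Set.pair_comm]; exact cs.altProd_mem_closure j i n

omit [Fintype B] in
include hM in
theorem exists_altProd_of_mem_closure {p : W} {i j : B} (hij : i ≠ j)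
    (hp : p ∈ Subgroup.closure {cs.simple i, cs.simple j}) :
    ∃ (a b : B) (n : ℕ), (a = i ∧ b = j ∨ a = j ∧ b = i) ∧ n ≤ M i j ∧ p = cs.altProd a b n := by
  have step : ∀ (t : B), t = i ∨ t = j → ∀ q : W,
      (∃ (a b : B) (n : ℕ), (a = i ∧ b = j ∨ a = j ∧ b = i) ∧ n ≤ M i j ∧ q = cs.altProd a b n) →
      ∃ (a b : B) (n : ℕ), (a = i ∧ b = j ∨ a = j ∧ b = i) ∧ n ≤ M i j ∧
        q * cs.simple t = cs.altProd a b n := by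
    rintro t ht q ⟨a, b, n, hab, hn, rfl⟩
    have down : ∀ a b n, (a = i ∧ b = j ∨ a = j ∧ b = i) → n + 1 ≤ M i j → altLetter a b n = t →
        ∃ (a' b' : B) (n' : ℕ), (a' = i ∧ b' = j ∨ a' = j ∧ b' = i) ∧ n' ≤ M i j ∧
          cs.altProd a b (n + 1) * cs.simple t = cs.altProd a' b' n' := by
      intro a b n hab hn hl
      exact ⟨a, b, n, hab, by omega, by
        rw [altProd_succ, hl, simple_mul_simple_cancel_right]⟩
    by_cases hl : altLetter a b n = t
    · rcases hn.lt_or_eq with hlt | rfl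
      · exact ⟨a, b, n + 1, hab, hlt, by rw [altProd_succ, hl]⟩
      · obtain ⟨k, hk⟩ := Nat.exists_eq_succ_of_ne_zero (hM i j)
        have hb : cs.altProd a b (M i j) = cs.altProd b a (M i j) := by
          rcases hab with ⟨rfl, rfl⟩ | ⟨rfl, rfl⟩
          · exact cs.altProd_braid _ _
          · exact (cs.altProd_braid _ _).symm
        have hd := down b a k (by grind) hk.ge
          (by rw [hk, Nat.succ_eq_add_one, altLetter_succ] at hl; exact hl)
        rw [← Nat.succ_eq_add_one, ← hk] at hd
        rwa [hb]
    · rcases n with _ | n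
      · exact ⟨t, a, 1, by grind [altLetter], by have := hM i j; omega, by simp [altProd_one]⟩
      · refine down a b n hab hn ?_
        by_contra hne
        exact hl (altLetter_eq_of_ne_succ (by grind) hne)
  induction hp using Subgroup.closure_induction_right with
  | one => exact ⟨i, j, 0, .inl ⟨rfl, rfl⟩, Nat.zero_le _, rfl⟩
  | mul_right x hx y hy ih =>
    rcases hy with rfl | rfl
    exacts [step i (.inl rfl) x ih, step j (.inr rfl) x ih]
  | mul_inv_cancel x hx y hy ih =>
    rcases hy with rfl | rfl
    · rw [inv_simple]; exact step i (.inl rfl) x ih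
    · rw [inv_simple]; exact step j (.inr rfl) x ih

include hM in
/-- A coset of the subgroup generated by `sᵢ`, `sⱼ` has only one element without descents among
`i`, `j`. -/
theorem eq_one_of_mem_closure {x p : W} {i j : B} (hij : i ≠ j)
    (hp : p ∈ Subgroup.closure {cs.simple i, cs.simple j})
    (hi : ¬cs.IsRightDescent x i) (hj : ¬cs.IsRightDescent x j)
    (hi' : ¬cs.IsRightDescent (x * p) i) (hj' : ¬cs.IsRightDescent (x * p) j) : p = 1 := by
  obtain ⟨a, b, n, hab, hn, rfl⟩ := cs.exists_altProd_of_mem_closure hM hij hp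
  rcases n with _ | n
  · rfl
  have hMab : M a b = M i j := by
    rcases hab with ⟨rfl, rfl⟩ | ⟨rfl, rfl⟩
    exacts [rfl, M.symmetric _ _]
  have h := cs.isRightDescent_mul_altProd hM (x := x) (i := a) (j := b) (n := n) (by grind)
    (by grind) (by grind) (by omega)
  rcases altLetter_eq_or a b n with e | e <;> grind

/-- The elements of the subgroup generated by `sᵢ`, `sⱼ`, listed as `altProd i j k` for
`0 ≤ k < M i j` and `altProd j i k` for `0 < k ≤ M i j`. -/
def residueElt (i j : B) : Bool × ℕ → W
  | (true, k) => cs.altProd i j k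
  | (false, k) => cs.altProd j i (k + 1)

omit [Fintype B] [DecidableEq B] in
theorem residueElt_mem_closure (i j : B) (a : Bool × ℕ) :
    cs.residueElt i j a ∈ Subgroup.closure {cs.simple i, cs.simple j} := by
  rcases a with ⟨_ | _, k⟩
  exacts [cs.altProd_mem_closure' i j _, cs.altProd_mem_closure i j _]

include hM in
theorem length_altProd {i j : B} (hij : i ≠ j) {n : ℕ} (hn : n ≤ M i j) :
    cs.length (cs.altProd i j n) = n := by
  have := cs.length_mul_altProd hM hij (x := 1) (cs.not_isRightDescent_one i)
    (cs.not_isRightDescent_one j) hn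
  simpa using this

include hM in
theorem residueElt_injOn {i j : B} (hij : i ≠ j) {a b : Bool × ℕ} (ha : a.2 < M i j)
    (hb : b.2 < M i j) (h : cs.residueElt i j a = cs.residueElt i j b) : a = b := by
  -- Equal elements have equal length. Then the letter that would extend the first word, which is
  -- not a descent, is the last letter of the second, which is one.
  have key : ∀ k k', k < M i j → k' < M i j → cs.altProd i j k ≠ cs.altProd j i (k' + 1) := by
    intro k k' hk hk' e
    have h1 := cs.length_altProd hM hij hk.le
    have h2 := cs.length_altProd hM hij.symm (n := k' + 1) (by rw [M.symmetric]; omega)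
    have hkk : k = k' + 1 := by rw [← h1, e, h2]
    have h3 := cs.not_isRightDescent_mul_altProd hM hij (x := 1) (cs.not_isRightDescent_one i)
      (cs.not_isRightDescent_one j) hk
    have h4 := cs.isRightDescent_mul_altProd hM hij.symm (x := 1) (cs.not_isRightDescent_one j)
      (cs.not_isRightDescent_one i) (n := k') (by rw [M.symmetric]; exact hk')
    rw [← e, ← altLetter_succ, ← hkk] at h4
    exact h3 h4
  rcases a with ⟨_ | _, k⟩ <;> rcases b with ⟨_ | _, k'⟩ <;> simp only [residueElt] at h ha hb
  · have h1 := cs.length_altProd hM hij.symm (n := k + 1) (by rw [M.symmetric]; omega)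
    have h2 := cs.length_altProd hM hij.symm (n := k' + 1) (by rw [M.symmetric]; omega)
    rw [h, h2] at h1
    have : k = k' := by omega
    rw [this]
  · exact absurd h.symm (key k' k hb ha)
  · exact absurd h (key k k' ha hb)
  · have h1 := cs.length_altProd hM hij ha.le
    rw [h, cs.length_altProd hM hij hb.le] at h1
    rw [h1]

include hM in
theorem existsUnique_residueElt (g : W) {i j : B} (hij : i ≠ j) :
    ∃! a : Bool × ℕ, a.2 < M i j ∧ ¬cs.IsRightDescent (g * (cs.residueElt i j a)⁻¹) i ∧
      ¬cs.IsRightDescent (g * (cs.residueElt i j a)⁻¹) j := by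
  obtain ⟨x, p, q, n, hpq, hg, -, hn, hi, hj⟩ := cs.exists_eq_mul_altProd_le hM g hij
  obtain ⟨a, ha, hxa⟩ : ∃ a : Bool × ℕ, a.2 < M i j ∧ g = x * cs.residueElt i j a := by
    have hpos := hM i j
    rcases hpq with ⟨rfl, rfl⟩ | ⟨rfl, rfl⟩
    · rcases hn.lt_or_eq with hlt | rfl
      · exact ⟨(true, n), hlt, hg⟩
      · refine ⟨(false, M p q - 1), by dsimp only; omega, ?_⟩
        rw [hg, altProd_braid, residueElt, Nat.sub_add_cancel (by omega)]
    · rcases n with _ | n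
      · exact ⟨(true, 0), by dsimp only; omega, hg⟩
      · exact ⟨(false, n), hn, hg⟩
  have hx : g * (cs.residueElt i j a)⁻¹ = x := by rw [hxa, mul_inv_cancel_right]
  refine ⟨a, ⟨ha, by rwa [hx], by rwa [hx]⟩, ?_⟩
  rintro b ⟨hb, hbi, hbj⟩
  have e : g * (cs.residueElt i j b)⁻¹ =
      x * (cs.residueElt i j a * (cs.residueElt i j b)⁻¹) := by rw [hxa, mul_assoc]
  rw [e] at hbi hbj
  have := cs.eq_one_of_mem_closure hM hij (mul_mem (cs.residueElt_mem_closure i j a)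
    (inv_mem (cs.residueElt_mem_closure i j b))) hi hj hbi hbj
  exact (cs.residueElt_injOn hM hij ha hb (mul_inv_eq_one.mp this)).symm

include hM in
-- Commuting generators have orthogonal roots, so each reflection fixes the root of the other.
theorem isRightDescent_mul_simple_iff {g : W} {i j : B} (hij : M i j = 2) :
    cs.IsRightDescent (g * cs.simple i) j ↔ cs.IsRightDescent g j := by
  have h : cs.geomRep hM (g * cs.simple i) (Pi.single j 1) =
      cs.geomRep hM g (Pi.single j 1) := by
    rw [geomRep_mul_simple, simpleReflection_simple, cosCoeff, hij]
    simp
  constructor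
  · intro hd
    exact cs.isRightDescent_of_geomRep_nonpos hM
      (h ▸ cs.geomRep_nonpos_of_isRightDescent hM hd)
  · intro hd
    exact cs.isRightDescent_of_geomRep_nonpos hM
      (h.symm ▸ cs.geomRep_nonpos_of_isRightDescent hM hd)

end Residue
end CoxeterSystem

open CoxeterSystem

/-! ### The curvature inequality and the lines that cannot cross -/

namespace Tessellation

variable {ℓ m : ℕ} {hℓ : 3 ≤ ℓ} {hm : 3 ≤ m} {W : Type*} [Group W]
  (cs : CoxeterSystem (tessellationMatrix ℓ m hℓ hm) W)

theorem matrix_ne_zero (i j : Fin 3) : tessellationMatrix ℓ m hℓ hm i j ≠ 0 := by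
  fin_cases i <;> fin_cases j <;> simp [tessellationMatrix] <;> omega

theorem matrix_zero_one : tessellationMatrix ℓ m hℓ hm 0 1 = m := rfl
theorem matrix_one_zero : tessellationMatrix ℓ m hℓ hm 1 0 = m := rfl
theorem matrix_one_two : tessellationMatrix ℓ m hℓ hm 1 2 = ℓ := rfl
theorem matrix_zero_two : tessellationMatrix ℓ m hℓ hm 0 2 = 2 := rfl
theorem matrix_two_zero : tessellationMatrix ℓ m hℓ hm 2 0 = 2 := rfl

/-- This amounts to cos(π/ℓ) ≥ sin(π/m), that is π/ℓ + π/m ≤ π/2, which is the hypothesis up to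
strictness. -/
theorem four_le_sq_cosCoeff_add_sq_cosCoeff (hyp : 4 < (ℓ - 2) * (m - 2)) :
    4 ≤ cosCoeff (tessellationMatrix ℓ m hℓ hm) 1 0 ^ 2 +
      cosCoeff (tessellationMatrix ℓ m hℓ hm) 1 2 ^ 2 := by
  rw [cosCoeff, cosCoeff, matrix_one_zero, matrix_one_two]
  obtain ⟨l, rfl⟩ := Nat.exists_eq_add_of_le hℓ
  obtain ⟨n, rfl⟩ := Nat.exists_eq_add_of_le hm
  have hyp' : (4 : ℝ) < (l + 1) * (n + 1) := by
    have : (3 + l - 2) * (3 + n - 2) = (l + 1) * (n + 1) := by congr 1 <;> omega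
    rw [this] at hyp
    exact_mod_cast hyp
  have hpi := Real.pi_pos
  have h1 : Real.sin (Real.pi / (3 + n : ℕ)) ≤ Real.cos (Real.pi / (3 + l : ℕ)) := by
    rw [← Real.cos_pi_div_two_sub]
    apply Real.cos_le_cos_of_nonneg_of_le_pi (by positivity)
    · have : 0 ≤ Real.pi / (3 + n : ℕ) := by positivity
      linarith
    · push_cast
      have : Real.pi / (3 + l) + Real.pi / (3 + n) ≤ Real.pi / 2 := by
        rw [div_add_div _ _ (by positivity) (by positivity),
          div_le_div_iff₀ (by positivity) (by positivity)]
        nlinarith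
      linarith
  have h0 : 0 ≤ Real.sin (Real.pi / (3 + n : ℕ)) := by
    apply Real.sin_nonneg_of_nonneg_of_le_pi (by positivity)
    rw [div_le_iff₀ (by positivity)]
    push_cast
    nlinarith
  have h2 := Real.sin_sq_add_cos_sq (Real.pi / (3 + n : ℕ))
  nlinarith

/-- Since α₀ and α₂ are orthogonal, `cosForm` of the two roots is κ₁₀² + κ₁₂² - 2, with κ =
`cosCoeff`; this is at least 2 by the preceding bound. -/
theorem not_isRightDescent_pair (hyp : 4 < (ℓ - 2) * (m - 2)) (g : W) :
    ¬(cs.geomRep matrix_ne_zero g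
        (simpleReflection (tessellationMatrix ℓ m hℓ hm) 0 (Pi.single 1 1)) ≤ 0 ∧
      cs.geomRep matrix_ne_zero g
        (simpleReflection (tessellationMatrix ℓ m hℓ hm) 2 (Pi.single 1 1)) ≤ 0) := by
  rintro ⟨h0, h2⟩
  have hr : cs.IsRealRoot matrix_ne_zero (Pi.single 1 1) := isRealRoot_single 1
  have hnn : ∀ i j : Fin 3, i ≠ j →
      0 ≤ simpleReflection (tessellationMatrix ℓ m hℓ hm) i (Pi.single j 1) := fun i j hij ↦ by
    rw [← geomRep_simple (cs := cs) matrix_ne_zero]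
    refine cs.geomRep_nonneg_of_not_isRightDescent matrix_ne_zero ?_
    have := cs.not_isRightDescent_mul_altProd matrix_ne_zero (x := 1) (i := i) (j := j) hij
      (cs.not_isRightDescent_one _) (cs.not_isRightDescent_one _) (n := 1)
      (two_le_of_ne hij (matrix_ne_zero i j))
    rwa [one_mul, altProd_one] at this
  refine (hr.simpleReflection 0).not_nonpos_of_two_le_cosForm (hr.simpleReflection 2)
    (hnn 0 1 (by decide)) (hnn 2 1 (by decide)) ?_ g h0 h2
  rw [simpleReflection_simple, simpleReflection_simple, cosForm_add_smul_left,
    cosForm_add_smul_right, cosForm_add_smul_right]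
  simp only [cosForm_single_left, coroot_single]
  have h02 : cosCoeff (tessellationMatrix ℓ m hℓ hm) 0 2 = 0 := by
    rw [cosCoeff, matrix_zero_two]; simp
  have := four_le_sq_cosCoeff_add_sq_cosCoeff (hℓ := hℓ) (hm := hm) hyp
  rw [h02, cosCoeff_self, cosCoeff_comm 0 1, cosCoeff_comm 2 1]
  linarith

/-- The reflections in the lines which join the ends of an edge to the centres of the two adjacent
faces, crosswise, cannot both shorten an element. -/
theorem not_isRightDescent_mul_two_of_mul_zero (hyp : 4 < (ℓ - 2) * (m - 2)) {g : W}
    (h : cs.IsRightDescent (g * cs.simple 0) 1) : ¬cs.IsRightDescent (g * cs.simple 2) 1 := by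
  intro h2
  refine not_isRightDescent_pair cs hyp g ⟨?_, ?_⟩
  · rw [← geomRep_mul_simple]; exact cs.geomRep_nonpos_of_isRightDescent _ h
  · rw [← geomRep_mul_simple]; exact cs.geomRep_nonpos_of_isRightDescent _ h2

/-- If all simple roots became negative, so would s₀α₁ and s₂α₁, which are nonnegative combinations
of them. -/
theorem not_forall_isRightDescent (hyp : 4 < (ℓ - 2) * (m - 2)) {g : W}
    (h0 : cs.IsRightDescent g 0) (h1 : cs.IsRightDescent g 1) : ¬cs.IsRightDescent g 2 := by
  intro h2
  have hn := fun i (h : cs.IsRightDescent g i) ↦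
    cs.geomRep_nonpos_of_isRightDescent matrix_ne_zero h
  have hpos : ∀ i j : Fin 3, i ≠ j → 0 ≤ cosCoeff (tessellationMatrix ℓ m hℓ hm) i j := by
    intro i j hij
    have h2 : (2 : ℝ) ≤ tessellationMatrix ℓ m hℓ hm i j := by
      have := two_le_of_ne hij (matrix_ne_zero (hℓ := hℓ) (hm := hm) i j)
      exact_mod_cast this
    refine mul_nonneg zero_le_two (Real.cos_nonneg_of_neg_pi_div_two_le_of_le ?_ ?_)
    · have : 0 ≤ Real.pi / tessellationMatrix ℓ m hℓ hm i j := by positivity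
      linarith [Real.pi_pos]
    · gcongr
  refine not_isRightDescent_pair cs hyp g ⟨?_, ?_⟩ <;>
    rw [simpleReflection_simple, map_add, map_smul]
  · exact add_nonpos (hn 1 h1) (smul_nonpos_of_nonneg_of_nonpos (hpos 0 1 (by decide)) (hn 0 h0))
  · exact add_nonpos (hn 1 h1) (smul_nonpos_of_nonneg_of_nonpos (hpos 2 1 (by decide)) (hn 2 h2))


/-! ### Lowest flags of faces and horizontal edges -/

variable {ℓ m : ℕ} {hℓ : 3 ≤ ℓ} {hm : 3 ≤ m} {W : Type*} [Group W]
  (cs : CoxeterSystem (tessellationMatrix ℓ m hℓ hm) W)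

/-- `g` is the shortest flag of its face. -/
def IsFaceMin (g : W) : Prop := ¬cs.IsRightDescent g 0 ∧ ¬cs.IsRightDescent g 1

/-- The rotation about the centre of the base face which moves the base flag to a flag at the top edge
when `m` is odd. -/
def topRotation : W := cs.altProd 0 1 (2 * (m / 2))

/-- `g` is the shortest flag of a face with two lowest vertices, which happens exactly when that face
lies on top of a horizontal edge. -/
def IsFlatFaceMin (g : W) : Prop :=
  Odd m ∧ ∃ _ : cs.length (g * cs.simple 2 * (topRotation cs)⁻¹) < cs.length g,
    IsFaceMin cs (g * cs.simple 2 * (topRotation cs)⁻¹) ∧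
      ¬IsFlatFaceMin (g * cs.simple 2 * (topRotation cs)⁻¹)
termination_by cs.length g

/-- The edge of the flag `g`, which is the lower flag of the edge, joins two vertices of the
same level: it is the top edge of one face and the bottom edge of another one. -/
def IsHorizontal (g : W) : Prop :=
  (Odd m ∧ IsFaceMin cs (g * (topRotation cs)⁻¹) ∧ ¬IsFlatFaceMin cs (g * (topRotation cs)⁻¹)) ∨
    IsFlatFaceMin cs g

theorem topRotation_length_le {g : W} (h : IsFaceMin cs g) :
    cs.length (g * topRotation cs) = cs.length g + 2 * (m / 2) :=
  cs.length_mul_altProd matrix_ne_zero (by decide) h.1 h.2 (by rw [matrix_zero_one]; omega)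

theorem topRotation_mul_zero (hodd : Odd m) :
    topRotation cs * cs.simple 0 = cs.altProd 0 1 m := by
  have e : ∀ n, n = 2 * (m / 2) + 1 → topRotation cs * cs.simple 0 = cs.altProd 0 1 n := by
    rintro _ rfl
    simp [altProd_succ, altLetter, topRotation]
  exact e m (by obtain ⟨k, rfl⟩ := hodd; omega)

theorem topRotation_one {g : W} (h : IsFaceMin cs g) : cs.IsRightDescent (g * topRotation cs) 1 := by
  have := cs.isRightDescent_mul_altProd matrix_ne_zero (i := 0) (j := 1) (by decide) h.1 h.2
    (n := 2 * (m / 2) - 1) (by rw [matrix_zero_one]; omega)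
  have e : 2 * (m / 2) - 1 + 1 = 2 * (m / 2) := by omega
  have e' : ¬Even (2 * (m / 2) - 1) := by
    rw [Nat.not_even_iff_odd]; exact ⟨m / 2 - 1, by omega⟩
  rw [e] at this
  simpa [altLetter, e', topRotation] using this

section OddFaces

variable (hodd : Odd m) {g : W} (h : IsFaceMin cs g)
include hodd h

theorem topRotation_not_zero : ¬cs.IsRightDescent (g * topRotation cs) 0 := by
  have := cs.not_isRightDescent_mul_altProd matrix_ne_zero (i := 0) (j := 1) (by decide) h.1 h.2
    (n := 2 * (m / 2)) (by rw [matrix_zero_one]; obtain ⟨k, rfl⟩ := hodd; omega)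
  simpa [altLetter, topRotation] using this

theorem topRotation_mul_zero_zero : cs.IsRightDescent (g * topRotation cs * cs.simple 0) 0 := by
  rw [isRightDescent_iff_not_isRightDescent_mul, simple_mul_simple_cancel_right]
  exact topRotation_not_zero cs hodd h

theorem topRotation_mul_zero_one : cs.IsRightDescent (g * topRotation cs * cs.simple 0) 1 := by
  have e : m = m - 1 + 1 := by omega
  have e' : Even (m - 1) := by obtain ⟨k, rfl⟩ := hodd; exact ⟨k, by omega⟩
  have := cs.isRightDescent_mul_altProd matrix_ne_zero (i := 1) (j := 0) (by decide) h.2 h.1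
    (n := m - 1) (by rw [matrix_one_zero]; omega)
  rw [← e] at this
  have hb := cs.altProd_braid 0 1
  rw [matrix_zero_one] at hb
  rw [mul_assoc, topRotation_mul_zero cs hodd, hb]
  simpa [altLetter, e'] using this

variable (hyp : 4 < (ℓ - 2) * (m - 2))
include hyp

/-- The longest flag of the face, one s₀ step further, has descents 0 and 1. As s₀ and s₂ commute,
it would have all three. -/
theorem topRotation_not_two : ¬cs.IsRightDescent (g * topRotation cs) 2 := fun h2 ↦ by
  refine not_forall_isRightDescent cs hyp (topRotation_mul_zero_zero cs hodd h)
    (topRotation_mul_zero_one cs hodd h) ?_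
  rwa [cs.isRightDescent_mul_simple_iff matrix_ne_zero matrix_zero_two]

/-- The non-crossing of lines makes the top edge of a face the bottom edge of its neighbour: 1 is a
descent after the s₀ step, so it cannot be one after the s₂ step. -/
theorem topRotation_mul_two_isFaceMin : IsFaceMin cs (g * topRotation cs * cs.simple 2) := by
  constructor
  · rw [cs.isRightDescent_mul_simple_iff matrix_ne_zero matrix_two_zero]
    exact topRotation_not_zero cs hodd h
  · exact not_isRightDescent_mul_two_of_mul_zero cs hyp (topRotation_mul_zero_one cs hodd h)

theorem topRotation_mul_two_length :
    cs.length (g * topRotation cs * cs.simple 2) = cs.length g + 2 * (m / 2) + 1 := by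
  rw [cs.not_isRightDescent_iff.mp (topRotation_not_two cs hodd h hyp),
    topRotation_length_le cs h]

theorem isFlatFaceMin_of_not (hg : ¬IsFlatFaceMin cs g) :
    IsFlatFaceMin cs (g * topRotation cs * cs.simple 2) := by
  rw [IsFlatFaceMin]
  rw [simple_mul_simple_cancel_right, mul_inv_cancel_right]
  exact ⟨hodd, by rw [topRotation_mul_two_length cs hodd h hyp]; omega, h, hg⟩

end OddFaces

theorem IsFlatFaceMin.exists_eq {g : W} (h : IsFlatFaceMin cs g) :
    Odd m ∧ ∃ w, IsFaceMin cs w ∧ ¬IsFlatFaceMin cs w ∧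
      g = w * topRotation cs * cs.simple 2 := by
  rw [IsFlatFaceMin] at h
  obtain ⟨ho, -, h1, h2⟩ := h
  exact ⟨ho, _, h1, h2, by simp⟩

/-! ### Consistency of the level increments on residues -/

section Levels

variable (hyp : 4 < (ℓ - 2) * (m - 2))
include hyp

theorem IsFlatFaceMin.isFaceMin {g : W} (h : IsFlatFaceMin cs g) : IsFaceMin cs g := by
  obtain ⟨ho, w, hw, -, rfl⟩ := h.exists_eq
  exact topRotation_mul_two_isFaceMin cs ho hw hyp

theorem IsFlatFaceMin.isRightDescent_two {g : W} (h : IsFlatFaceMin cs g) :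
    cs.IsRightDescent g 2 := by
  obtain ⟨ho, w, hw, -, rfl⟩ := h.exists_eq
  rw [isRightDescent_iff_not_isRightDescent_mul, simple_mul_simple_cancel_right]
  exact topRotation_not_two cs ho hw hyp

/-- Crossing the edge exchanges the two alternatives of `IsHorizontal`: top edge of the face below,
bottom edge of the face above. The descent condition selects the lower side. -/
theorem isHorizontal_mul_two_iff {g : W}
    (h2 : ¬cs.IsRightDescent g 2) : IsHorizontal cs (g * cs.simple 2) ↔ IsHorizontal cs g := by
  constructor
  · rintro (⟨ho, hf, -⟩ | hf)
    · exfalso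
      obtain ⟨w, hw⟩ : ∃ w, w = g * cs.simple 2 * (topRotation cs)⁻¹ := ⟨_, rfl⟩
      have e : w * topRotation cs = g * cs.simple 2 := by rw [hw, inv_mul_cancel_right]
      rw [← hw] at hf
      refine topRotation_not_two cs ho hf hyp ?_
      rw [e, isRightDescent_iff_not_isRightDescent_mul, simple_mul_simple_cancel_right]
      exact h2
    · obtain ⟨ho, w, hw, hw', e⟩ := hf.exists_eq
      have e' : g * (topRotation cs)⁻¹ = w := by
        rw [mul_right_cancel e, mul_inv_cancel_right]
      exact .inl ⟨ho, by rwa [e'], by rwa [e']⟩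
  · rintro (⟨ho, hf, hn⟩ | hf)
    · right
      have := isFlatFaceMin_of_not cs ho hf hyp hn
      rwa [inv_mul_cancel_right] at this
    · exact absurd (hf.isRightDescent_two cs hyp) h2

/-- A face coset has only one shortest flag, so each alternative in `IsHorizontal` determines the
alternating word, and lengths then determine `j`. -/
theorem isHorizontal_mul_altProd_iff {g : W} (hg : IsFaceMin cs g) {j : ℕ} (hj : 2 * j < m) :
    IsHorizontal cs (g * cs.altProd 0 1 (2 * j)) ↔
      (j = 0 ∧ IsFlatFaceMin cs g) ∨ (Odd m ∧ j = m / 2 ∧ ¬IsFlatFaceMin cs g) := by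
  have hM := matrix_ne_zero (hℓ := hℓ) (hm := hm)
  constructor
  · rintro (⟨ho, hf, hn⟩ | hf)
    · rw [mul_assoc] at hf hn
      have h1 := cs.eq_one_of_mem_closure hM (i := 0) (j := 1) (by decide)
        (mul_mem (cs.altProd_mem_closure 0 1 (2 * j))
          (inv_mem (cs.altProd_mem_closure 0 1 (2 * (m / 2))))) hg.1 hg.2 hf.1 hf.2
      rw [topRotation, h1, mul_one] at hn
      have h2 := congrArg cs.length (mul_inv_eq_one.mp h1)
      rw [cs.length_altProd hM (by decide) (by rw [matrix_zero_one]; omega),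
        cs.length_altProd hM (by decide) (by rw [matrix_zero_one]; omega)] at h2
      exact .inr ⟨ho, by omega, hn⟩
    · have hf' := hf.isFaceMin cs hyp
      have h1 := cs.eq_one_of_mem_closure hM (i := 0) (j := 1) (by decide)
        (cs.altProd_mem_closure 0 1 (2 * j)) hg.1 hg.2 hf'.1 hf'.2
      rw [h1, mul_one] at hf
      have h2 := congrArg cs.length h1
      rw [cs.length_altProd hM (by decide) (by rw [matrix_zero_one]; omega), length_one] at h2
      exact .inl ⟨by omega, hf⟩
  · rintro (⟨rfl, hf⟩ | ⟨ho, rfl, hn⟩)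
    · exact .inr (by simpa using hf)
    · refine .inl ⟨ho, ?_⟩
      have : g * cs.altProd 0 1 (2 * (m / 2)) * (topRotation cs)⁻¹ = g := by
        rw [topRotation, mul_inv_cancel_right]
      rw [this]
      exact ⟨hg, hn⟩

theorem not_isHorizontal_mul_altProd {g : W} (hg : IsFaceMin cs g) {j : ℕ} (hj : 2 * j + 1 < m) :
    ¬IsHorizontal cs (g * cs.altProd 1 0 (2 * j + 1)) := by
  have hM := matrix_ne_zero (hℓ := hℓ) (hm := hm)
  rintro (⟨-, hf, -⟩ | hf)
  · rw [mul_assoc] at hf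
    have h1 := cs.eq_one_of_mem_closure hM (i := 0) (j := 1) (by decide)
        (mul_mem (cs.altProd_mem_closure' 0 1 (2 * j + 1))
          (inv_mem (cs.altProd_mem_closure 0 1 (2 * (m / 2))))) hg.1 hg.2 hf.1 hf.2
    have h2 := congrArg cs.length (mul_inv_eq_one.mp h1)
    rw [cs.length_altProd hM (by decide) (by rw [matrix_one_zero]; omega),
        cs.length_altProd hM (by decide) (by rw [matrix_zero_one]; omega)] at h2
    omega
  · have hf' := hf.isFaceMin cs hyp
    have h1 := cs.eq_one_of_mem_closure hM (i := 0) (j := 1) (by decide)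
        (cs.altProd_mem_closure' 0 1 (2 * j + 1)) hg.1 hg.2 hf'.1 hf'.2
    have h2 := congrArg cs.length h1
    rw [cs.length_altProd hM (by decide) (by rw [matrix_one_zero]; omega), length_one] at h2
    omega

omit hyp in
open Classical in
/-- The increment of the distance from the base vertex along the edges of the weak order. -/
noncomputable def levelStep (g : W) (i : Fin 3) : ℕ := if i = 0 ∧ ¬IsHorizontal cs g then 1 else 0

open Classical in
-- Every s₀ step on this side goes up, except along a horizontal edge: the first edge of a flat
-- face, or the last edge of a non-flat face when m is odd. Both corrections stand on the left to
-- avoid truncated subtraction.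
theorem sum_levelStep_left {g : W} (hg : IsFaceMin cs g) {n : ℕ} (hn : n ≤ m) :
    ∑ k ∈ Finset.range n, levelStep cs (g * cs.altProd 0 1 k) (altLetter 0 1 k) +
      (if IsFlatFaceMin cs g ∧ 0 < n then 1 else 0) +
      (if Odd m ∧ ¬IsFlatFaceMin cs g ∧ n = m then 1 else 0) = (n + 1) / 2 := by
  induction n with
  | zero => simp; omega
  | succ n ih =>
    have ih := ih (by omega)
    rw [Finset.sum_range_succ]
    rcases Nat.even_or_odd n with he | ho
    · obtain ⟨j, rfl⟩ := he
      rw [← two_mul] at ih hn ⊢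
      have hH := isHorizontal_mul_altProd_iff cs hyp hg (j := j) (by omega)
      have hs : levelStep cs (g * cs.altProd 0 1 (2 * j)) (altLetter 0 1 (2 * j)) =
          if IsHorizontal cs (g * cs.altProd 0 1 (2 * j)) then 0 else 1 := by
        simp [levelStep, altLetter]
      rw [hs]
      simp only [hH]
      have hlast : 2 * j + 1 = m ↔ Odd m ∧ j = m / 2 := by
        constructor
        · rintro rfl; exact ⟨⟨j, rfl⟩, by omega⟩
        · rintro ⟨⟨k, rfl⟩, h⟩; omega
      by_cases hB : IsFlatFaceMin cs g <;> by_cases ho : Odd m <;> by_cases hj : j = 0 <;>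
        by_cases hjm : j = m / 2 <;> simp [hB, ho] at ih ⊢ <;> (try split_ifs at ih ⊢) <;> omega
    · have hs : levelStep cs (g * cs.altProd 0 1 n) (altLetter 0 1 n) = 0 := by
        simp [levelStep, altLetter, Nat.not_even_iff_odd.mpr ho]
      rw [hs]
      obtain ⟨j, rfl⟩ := ho
      have h1 : ¬(Odd m ∧ ¬IsFlatFaceMin cs g ∧ 2 * j + 1 + 1 = m) := by
        rintro ⟨⟨k, rfl⟩, -, h⟩; omega
      have h2 : ¬(Odd m ∧ ¬IsFlatFaceMin cs g ∧ 2 * j + 1 = m) := by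
        rintro ⟨-, -, h⟩; omega
      rw [if_neg h1]
      rw [if_neg h2] at ih
      by_cases hB : IsFlatFaceMin cs g <;> simp [hB] at ih ⊢ <;> omega

theorem sum_levelStep_right {g : W} (hg : IsFaceMin cs g) {n : ℕ} (hn : n ≤ m) :
    ∑ k ∈ Finset.range n, levelStep cs (g * cs.altProd 1 0 k) (altLetter 1 0 k) = n / 2 := by
  induction n with
  | zero => simp
  | succ n ih =>
    rw [Finset.sum_range_succ, ih (by omega)]
    rcases Nat.even_or_odd n with he | ho
    · have : levelStep cs (g * cs.altProd 1 0 n) (altLetter 1 0 n) = 0 := by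
        simp [levelStep, altLetter, he]
      rw [this]
      obtain ⟨j, rfl⟩ := he
      omega
    · obtain ⟨j, rfl⟩ := ho
      have := not_isHorizontal_mul_altProd cs hyp hg (j := j) (by omega)
      have : levelStep cs (g * cs.altProd 1 0 (2 * j + 1)) (altLetter 1 0 (2 * j + 1)) = 1 := by
        simp [levelStep, altLetter, this]
      rw [this]
      omega

/-- Around a face with m odd, the path starting with s₀ has one more s₀ step than the other, but
exactly one of its s₀ steps is horizontal. Around an edge the two sides agree by
`isHorizontal_mul_two_iff`, and around a vertex nothing changes. -/
theorem levelStep_consistent (x : W) (i j : Fin 3) (hij : i ≠ j) (hi : ¬cs.IsRightDescent x i)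
    (hj : ¬cs.IsRightDescent x j) :
    ∑ k ∈ Finset.range (tessellationMatrix ℓ m hℓ hm i j),
        levelStep cs (x * cs.altProd i j k) (altLetter i j k) =
      ∑ k ∈ Finset.range (tessellationMatrix ℓ m hℓ hm i j),
        levelStep cs (x * cs.altProd j i k) (altLetter j i k) := by
  have h01 : ∀ x : W, IsFaceMin cs x →
      ∑ k ∈ Finset.range m, levelStep cs (x * cs.altProd 0 1 k) (altLetter 0 1 k) =
        ∑ k ∈ Finset.range m, levelStep cs (x * cs.altProd 1 0 k) (altLetter 1 0 k) := by
    intro x hx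
    have h1 := sum_levelStep_left cs hyp hx le_rfl
    rw [sum_levelStep_right cs hyp hx le_rfl]
    have hm0 : 0 < m := by omega
    rcases Nat.even_or_odd m with he | ho
    · have hB : ¬IsFlatFaceMin cs x := fun h ↦ by
        have := h.exists_eq.1
        exact Nat.not_even_iff_odd.mpr this he
      rw [if_neg (by tauto), if_neg (by rw [← Nat.not_even_iff_odd]; tauto)] at h1
      obtain ⟨j, rfl⟩ := he
      omega
    · obtain ⟨j, hj⟩ := id ho
      by_cases hB : IsFlatFaceMin cs x
      · rw [if_pos ⟨hB, hm0⟩, if_neg (by tauto)] at h1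
        omega
      · rw [if_neg (by tauto), if_pos ⟨ho, hB, rfl⟩] at h1
        omega
  have h02 : ∀ x : W, ¬cs.IsRightDescent x 2 →
      ∑ k ∈ Finset.range 2, levelStep cs (x * cs.altProd 0 2 k) (altLetter 0 2 k) =
        ∑ k ∈ Finset.range 2, levelStep cs (x * cs.altProd 2 0 k) (altLetter 2 0 k) := by
    intro x h2
    have e1 : ∀ y : W, levelStep cs y 2 = 0 := fun y ↦ by simp [levelStep]
    have e2 : levelStep cs (x * cs.simple 2) 0 = levelStep cs x 0 := by
      have h := isHorizontal_mul_two_iff cs hyp h2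
      by_cases hH : IsHorizontal cs x
      · simp [levelStep, hH, h.mpr hH]
      · simp [levelStep, hH, mt h.mp hH]
    have l1 : altLetter (0 : Fin 3) 2 1 = 2 := rfl
    have l2 : altLetter (2 : Fin 3) 0 1 = 0 := rfl
    simp only [Finset.sum_range_succ, Finset.sum_range_zero, altProd_zero, altProd_one, mul_one,
      l1, l2, altLetter_zero, e1, e2, zero_add, add_zero]
  have h12 : ∀ (i j : Fin 3), i ≠ 0 → j ≠ 0 → ∀ (x : W) k,
      levelStep cs (x * cs.altProd i j k) (altLetter i j k) = 0 := by
    intro i j hi hj x k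
    rcases altLetter_eq_or i j k with h | h <;> simp [levelStep, h, hi, hj]
  fin_cases i <;> fin_cases j <;> first | exact absurd rfl hij | skip
  · exact h01 x ⟨hi, hj⟩
  · exact h02 x hj
  · exact (h01 x ⟨hj, hi⟩).symm
  · simp only [Fin.mk_one, Fin.reduceFinMk]
    rw [Finset.sum_congr rfl fun k _ ↦ h12 1 2 (by decide) (by decide) x k,
      Finset.sum_congr rfl fun k _ ↦ h12 2 1 (by decide) (by decide) x k]
  · exact (h02 x hi).symm
  · simp only [Fin.mk_one, Fin.reduceFinMk]
    rw [Finset.sum_congr rfl fun k _ ↦ h12 1 2 (by decide) (by decide) x k,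
      Finset.sum_congr rfl fun k _ ↦ h12 2 1 (by decide) (by decide) x k]

end Levels


/-! ### The level function on flags -/

section Level

variable {ℓ m : ℕ} {hℓ : 3 ≤ ℓ} {hm : 3 ≤ m} {W : Type*} [Group W]
  (cs : CoxeterSystem (tessellationMatrix ℓ m hℓ hm) W)

/-- The graph distance of the vertex of the flag `g` from the base vertex. -/
noncomputable def level (g : W) : ℕ := cs.potential (levelStep cs) g

theorem level_one : level cs 1 = 0 := cs.potential_one _

open Classical in
theorem levelStep_zero (g : W) : levelStep cs g 0 = if IsHorizontal cs g then 0 else 1 := by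
  by_cases h : IsHorizontal cs g <;> simp [levelStep, h]

theorem levelStep_of_ne_zero (g : W) {i : Fin 3} (hi : i ≠ 0) : levelStep cs g i = 0 := by
  simp [levelStep, hi]

variable (hyp : 4 < (ℓ - 2) * (m - 2))
include hyp

theorem level_mul_simple {g : W} {i : Fin 3} (h : ¬cs.IsRightDescent g i) :
    level cs (g * cs.simple i) = level cs g + levelStep cs g i :=
  cs.potential_mul_simple matrix_ne_zero (levelStep_consistent cs hyp) h

theorem level_mul_simple_of_ne_zero (g : W) {i : Fin 3} (hi : i ≠ 0) :
    level cs (g * cs.simple i) = level cs g := by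
  by_cases h : cs.IsRightDescent g i
  · have h' := cs.isRightDescent_iff_not_isRightDescent_mul.mp h
    have := level_mul_simple cs hyp h'
    rwa [simple_mul_simple_cancel_right, levelStep_of_ne_zero cs _ hi, add_zero, eq_comm] at this
  · rw [level_mul_simple cs hyp h, levelStep_of_ne_zero cs _ hi, add_zero]

theorem level_mul_of_mem (g : W) {p : W}
    (hp : p ∈ Subgroup.closure {cs.simple 1, cs.simple 2}) : level cs (g * p) = level cs g := by
  induction hp using Subgroup.closure_induction_right with
  | one => rw [mul_one]
  | mul_right x hx y hy ih =>
    rw [← mul_assoc]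
    rcases hy with rfl | rfl <;> rw [level_mul_simple_of_ne_zero cs hyp _ (by decide), ih]
  | mul_inv_cancel x hx y hy ih =>
    rw [← mul_assoc]
    rcases hy with rfl | rfl <;>
      rw [inv_simple, level_mul_simple_of_ne_zero cs hyp _ (by decide), ih]

open Classical in
theorem level_mul_zero {g : W} (h : ¬cs.IsRightDescent g 0) :
    level cs (g * cs.simple 0) = level cs g + if IsHorizontal cs g then 0 else 1 := by
  rw [level_mul_simple cs hyp h, levelStep_zero]

theorem level_mul_zero_le (g : W) : level cs (g * cs.simple 0) ≤ level cs g + 1 := by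
  by_cases h : cs.IsRightDescent g 0
  · have h' := cs.isRightDescent_iff_not_isRightDescent_mul.mp h
    have := level_mul_zero cs hyp h'
    rw [simple_mul_simple_cancel_right] at this
    omega
  · rw [level_mul_zero cs hyp h]
    split_ifs <;> omega

open Classical in
theorem level_mul_altProd_left {g : W} (hg : IsFaceMin cs g) {n : ℕ} (hn : n < m) :
    level cs (g * cs.altProd 0 1 n) + (if IsFlatFaceMin cs g ∧ 0 < n then 1 else 0) =
      level cs g + (n + 1) / 2 := by
  have h := sum_levelStep_left cs hyp hg hn.le
  rw [if_neg (c := _ ∧ _ ∧ n = m) (by rintro ⟨-, -, h⟩; omega), add_zero] at h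
  rw [level, cs.potential_mul_altProd matrix_ne_zero (levelStep_consistent cs hyp) (by decide)
    hg.1 hg.2 (by rw [matrix_zero_one]; exact hn.le), add_assoc, h, level]

theorem level_mul_altProd_right {g : W} (hg : IsFaceMin cs g) {n : ℕ} (hn : n ≤ m) :
    level cs (g * cs.altProd 1 0 n) = level cs g + n / 2 := by
  rw [level, cs.potential_mul_altProd matrix_ne_zero (levelStep_consistent cs hyp) (by decide)
    hg.2 hg.1 (by rw [matrix_one_zero]; exact hn), sum_levelStep_right cs hyp hg hn, level]

theorem level_mul_topRotation (hodd : Odd m) {g : W} (hg : IsFaceMin cs g)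
    (hn : ¬IsFlatFaceMin cs g) :
    level cs (g * topRotation cs) = level cs g + m / 2 := by
  have := level_mul_altProd_left cs hyp hg (n := 2 * (m / 2))
    (by obtain ⟨k, rfl⟩ := hodd; omega)
  rw [if_neg (by tauto)] at this
  rw [topRotation]
  omega

/-- The first edge on a shortest path from a vertex to the base vertex, in terms of the shortest flag
of that vertex. -/
theorem level_mul_zero_add_one {g : W} (h0 : cs.IsRightDescent g 0)
    (h1 : ¬cs.IsRightDescent g 1) (h2 : ¬cs.IsRightDescent g 2) :
    level cs (g * cs.simple 0) + 1 = level cs g := by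
  have h0' := cs.isRightDescent_iff_not_isRightDescent_mul.mp h0
  have h := level_mul_zero cs hyp h0'
  rw [simple_mul_simple_cancel_right] at h
  rw [h, if_neg]
  -- A horizontal edge would give `g` the descent 1, as the top edge of a face, or the descent 2, as
  -- the bottom edge of a flat one; the shortest flag of a vertex has neither.
  rintro (⟨ho, hf, hn⟩ | hf)
  · have := topRotation_mul_zero_one cs ho hf
    rw [inv_mul_cancel_right, simple_mul_simple_cancel_right] at this
    exact h1 this
  · have := hf.isRightDescent_two cs hyp
    rw [cs.isRightDescent_mul_simple_iff matrix_ne_zero matrix_zero_two] at this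
    exact h2 this

omit hyp in
theorem exists_vertexMin (g : W) : ∃ p ∈ Subgroup.closure {cs.simple 1, cs.simple 2},
    ¬cs.IsRightDescent (g * p) 1 ∧ ¬cs.IsRightDescent (g * p) 2 := by
  obtain ⟨x, p, q, n, hpq, hg, -, -, h1, h2⟩ :=
    cs.exists_eq_mul_altProd_le matrix_ne_zero g (i := 1) (j := 2) (by decide)
  have hx : g * (cs.altProd p q n)⁻¹ = x := by rw [hg, mul_inv_cancel_right]
  refine ⟨(cs.altProd p q n)⁻¹, inv_mem ?_, by rwa [hx], by rwa [hx]⟩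
  rcases hpq with ⟨rfl, rfl⟩ | ⟨rfl, rfl⟩
  exacts [cs.altProd_mem_closure _ _ _, cs.altProd_mem_closure' _ _ _]

omit hyp in
theorem isRightDescent_zero_of_ne_one {g : W} (hg : g ≠ 1) (h1 : ¬cs.IsRightDescent g 1)
    (h2 : ¬cs.IsRightDescent g 2) : cs.IsRightDescent g 0 := by
  obtain ⟨i, hi⟩ := cs.exists_rightDescent_of_ne_one hg
  fin_cases i
  exacts [hi, absurd hi h1, absurd hi h2]

theorem exists_level_mul_add_one (g : W)
    (hg : g ∉ Subgroup.closure {cs.simple 1, cs.simple 2}) :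
    ∃ p ∈ Subgroup.closure {cs.simple 1, cs.simple 2},
      level cs (g * p * cs.simple 0) + 1 = level cs g := by
  obtain ⟨p, hp, h1, h2⟩ := exists_vertexMin cs g
  refine ⟨p, hp, ?_⟩
  have hne : g * p ≠ 1 := fun h ↦ hg (by
    rw [eq_inv_of_mul_eq_one_left h]; exact inv_mem hp)
  rw [level_mul_zero_add_one cs hyp (isRightDescent_zero_of_ne_one cs hne h1 h2) h1 h2,
    level_mul_of_mem cs hyp g hp]

omit hyp in
theorem finite_vertexStabilizer :
    (Subgroup.closure {cs.simple 1, cs.simple 2} : Set W).Finite := by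
  refine ((Finset.range (ℓ + 1)).finite_toSet.image (cs.altProd 1 2) |>.union
    ((Finset.range (ℓ + 1)).finite_toSet.image (cs.altProd 2 1))).subset fun p hp ↦ ?_
  obtain ⟨a, b, n, hab, hn, rfl⟩ :=
    cs.exists_altProd_of_mem_closure matrix_ne_zero (i := 1) (j := 2) (by decide) hp
  rw [matrix_one_two] at hn
  rcases hab with ⟨rfl, rfl⟩ | ⟨rfl, rfl⟩
  exacts [.inl ⟨n, by simpa using Nat.lt_succ_of_le hn, rfl⟩,
    .inr ⟨n, by simpa using Nat.lt_succ_of_le hn, rfl⟩]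

theorem finite_level_eq (n : ℕ) : {g : W | level cs g = n}.Finite := by
  have hP := finite_vertexStabilizer cs
  induction n with
  | zero =>
    refine hP.subset fun g hg ↦ ?_
    by_contra h
    obtain ⟨p, -, hp⟩ := exists_level_mul_add_one cs hyp g h
    rw [Set.mem_ofPred_eq] at hg
    omega
  | succ n ih =>
    refine (hP.union ((ih.prod hP).image fun a ↦ a.1 * cs.simple 0 * a.2)).subset fun g hg ↦ ?_
    by_cases h : g ∈ Subgroup.closure {cs.simple 1, cs.simple 2}
    · exact .inl h
    obtain ⟨p, hp, hl⟩ := exists_level_mul_add_one cs hyp g h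
    rw [Set.mem_ofPred_eq] at hg
    refine .inr ⟨(g * p * cs.simple 0, p⁻¹), ⟨?_, inv_mem hp⟩, by simp [mul_assoc]⟩
    change level cs (g * p * cs.simple 0) = n
    omega

end Level

/-! ### The level is the graph distance -/

section Graph

variable {ℓ m : ℕ} {hℓ : 3 ≤ ℓ} {hm : 3 ≤ m}

local notation "cs₀" => CoxeterMatrix.toCoxeterSystem (tessellationMatrix ℓ m hℓ hm)

theorem vertexStabilizer_eq : vertexStabilizer ℓ m hℓ hm =
    Subgroup.closure {(cs₀).simple 1, (cs₀).simple 2} := rfl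

variable (hyp : 4 < (ℓ - 2) * (m - 2))
include hyp

/-- The left translation by `h` accommodates an arbitrary base vertex: `h` will be the inverse of
one of its flags. -/
theorem level_eq_of_mk_eq (h : TessellationGroup ℓ m hℓ hm) {g g' : TessellationGroup ℓ m hℓ hm}
    (e : (QuotientGroup.mk g : TessellationVertex ℓ m hℓ hm) = QuotientGroup.mk g') :
    level cs₀ (h * g) = level cs₀ (h * g') := by
  rw [QuotientGroup.eq, vertexStabilizer_eq] at e
  have := level_mul_of_mem cs₀ hyp (h * g) e
  rw [← this, mul_assoc, mul_inv_cancel_left]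

theorem level_le_of_adj (h : TessellationGroup ℓ m hℓ hm) {g g' : TessellationGroup ℓ m hℓ hm}
    (e : (tessellationGraph ℓ m hℓ hm).Adj (QuotientGroup.mk g) (QuotientGroup.mk g')) :
    level cs₀ (h * g') ≤ level cs₀ (h * g) + 1 := by
  rw [tessellationGraph, SimpleGraph.fromRel_adj] at e
  rcases e.2 with ⟨a, h1, h2⟩ | ⟨a, h1, h2⟩
  · rw [level_eq_of_mk_eq hyp h h1, level_eq_of_mk_eq hyp h h2, ← mul_assoc]
    exact level_mul_zero_le cs₀ hyp (h * a)
  · rw [level_eq_of_mk_eq hyp h h1, level_eq_of_mk_eq hyp h h2, ← mul_assoc]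
    have := level_mul_zero_le cs₀ hyp (h * a * (cs₀).simple 0)
    rwa [simple_mul_simple_cancel_right] at this

theorem level_le_walk_length (h : TessellationGroup ℓ m hℓ hm) {x y : TessellationVertex ℓ m hℓ hm}
    (w : (tessellationGraph ℓ m hℓ hm).Walk x y) (g g' : TessellationGroup ℓ m hℓ hm)
    (hx : x = QuotientGroup.mk g) (hy : y = QuotientGroup.mk g') :
    level cs₀ (h * g') ≤ level cs₀ (h * g) + w.length := by
  induction w generalizing g with
  | nil => rw [level_eq_of_mk_eq hyp h (hy.symm.trans hx), SimpleGraph.Walk.length_nil, add_zero]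
  | @cons u v w hadj p ih =>
    obtain ⟨a, rfl⟩ := QuotientGroup.mk_surjective v
    rw [hx] at hadj
    have h1 := level_le_of_adj hyp h hadj
    have h2 := ih a rfl hy
    rw [SimpleGraph.Walk.length_cons]
    omega

theorem exists_walk_length_eq_level (h g : TessellationGroup ℓ m hℓ hm) :
    ∃ w : (tessellationGraph ℓ m hℓ hm).Walk (QuotientGroup.mk h) (QuotientGroup.mk g),
      w.length = level cs₀ (h⁻¹ * g) := by
  induction hn : level cs₀ (h⁻¹ * g) generalizing g with
  | zero =>
    have hmem : h⁻¹ * g ∈ vertexStabilizer ℓ m hℓ hm := by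
      by_contra hne
      obtain ⟨p, -, hp⟩ := exists_level_mul_add_one cs₀ hyp (h⁻¹ * g) hne
      omega
    rw [← QuotientGroup.eq.mpr hmem]
    exact ⟨.nil, rfl⟩
  | succ n ih =>
    have hne : h⁻¹ * g ∉ vertexStabilizer ℓ m hℓ hm := fun hmem ↦ by
      have := level_mul_of_mem cs₀ hyp 1 hmem
      rw [one_mul, level_one] at this
      omega
    obtain ⟨p, hp, hl⟩ := exists_level_mul_add_one cs₀ hyp (h⁻¹ * g) hne
    obtain ⟨w, hw⟩ := ih (g * p * (cs₀).simple 0) (by rw [← mul_assoc, ← mul_assoc]; omega)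
    have hmk : (QuotientGroup.mk g : TessellationVertex ℓ m hℓ hm) = QuotientGroup.mk (g * p) := by
      rw [QuotientGroup.eq, inv_mul_cancel_left]; exact hp
    have hadj : (tessellationGraph ℓ m hℓ hm).Adj (QuotientGroup.mk (g * p * (cs₀).simple 0))
        (QuotientGroup.mk g) := by
      rw [tessellationGraph, SimpleGraph.fromRel_adj]
      refine ⟨fun e ↦ ?_, .inr ⟨g * p, hmk, rfl⟩⟩
      have := level_eq_of_mk_eq hyp h⁻¹ e
      rw [← mul_assoc, ← mul_assoc] at this
      omega
    exact ⟨w.concat hadj, by rw [SimpleGraph.Walk.length_concat, hw]⟩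

theorem edist_eq_level (h g : TessellationGroup ℓ m hℓ hm) :
    (tessellationGraph ℓ m hℓ hm).edist (QuotientGroup.mk h) (QuotientGroup.mk g) =
      level cs₀ (h⁻¹ * g) := by
  apply le_antisymm
  · obtain ⟨w, hw⟩ := exists_walk_length_eq_level hyp h g
    rw [← hw]
    exact w.edist_le
  · refine le_iInf fun w ↦ ?_
    have := level_le_walk_length hyp h⁻¹ w h g rfl rfl
    rw [inv_mul_cancel, level_one, zero_add] at this
    exact_mod_cast this

/-- The vertices at distance `n` from a given vertex, as the image of the shortest flags of the
vertices at distance `n` from the base vertex. -/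
theorem graphSphere_eq_image (h : TessellationGroup ℓ m hℓ hm) (n : ℕ) :
    graphSphere (tessellationGraph ℓ m hℓ hm) (QuotientGroup.mk h) n =
      (fun g ↦ QuotientGroup.mk (h * g)) ''
        {g | level cs₀ g = n ∧ ¬(cs₀).IsRightDescent g 1 ∧ ¬(cs₀).IsRightDescent g 2} := by
  ext x
  obtain ⟨g, rfl⟩ := QuotientGroup.mk_surjective x
  rw [graphSphere, Set.mem_ofPred_eq, edist_eq_level hyp, Nat.cast_inj]
  constructor
  · intro hn
    obtain ⟨p, hp, h1, h2⟩ := exists_vertexMin cs₀ (h⁻¹ * g)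
    refine ⟨h⁻¹ * g * p, ⟨by rw [level_mul_of_mem cs₀ hyp _ hp, hn], h1, h2⟩, ?_⟩
    dsimp only
    rw [mul_assoc, mul_inv_cancel_left, eq_comm, QuotientGroup.eq, inv_mul_cancel_left]
    exact hp
  · rintro ⟨a, ⟨hn, -, -⟩, e⟩
    rw [← hn, ← level_eq_of_mk_eq hyp h⁻¹ e, inv_mul_cancel_left]

theorem finite_graphSphere (o : TessellationVertex ℓ m hℓ hm) (n : ℕ) :
    (graphSphere (tessellationGraph ℓ m hℓ hm) o n).Finite := by
  obtain ⟨h, rfl⟩ := QuotientGroup.mk_surjective o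
  rw [graphSphere_eq_image hyp]
  exact ((finite_level_eq cs₀ hyp n).subset fun g hg ↦ hg.1).image _

theorem ncard_graphSphere (o : TessellationVertex ℓ m hℓ hm) (n : ℕ) :
    (graphSphere (tessellationGraph ℓ m hℓ hm) o n).ncard =
      {g | level cs₀ g = n ∧ ¬(cs₀).IsRightDescent g 1 ∧ ¬(cs₀).IsRightDescent g 2}.ncard := by
  obtain ⟨h, rfl⟩ := QuotientGroup.mk_surjective o
  rw [graphSphere_eq_image hyp]
  refine Set.InjOn.ncard_image fun a ha b hb hab ↦ ?_
  have hp : a⁻¹ * b ∈ Subgroup.closure {(cs₀).simple 1, (cs₀).simple 2} := by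
    have := QuotientGroup.eq.mp hab
    rwa [mul_inv_rev, mul_assoc, inv_mul_cancel_left] at this
  have := (cs₀).eq_one_of_mem_closure matrix_ne_zero (x := a) (by decide) hp ha.2.1 ha.2.2
    (by rw [mul_inv_cancel_left]; exact hb.2.1) (by rw [mul_inv_cancel_left]; exact hb.2.2)
  exact inv_mul_eq_one.mp this

end Graph


/-! ### Generating series of flags, vertices, edges and faces by level -/

section Gen

open PowerSeries (X)

variable {ℓ m : ℕ} {hℓ : 3 ≤ ℓ} {hm : 3 ≤ m} {W : Type*} [Group W]
  (cs : CoxeterSystem (tessellationMatrix ℓ m hℓ hm) W) (hyp : 4 < (ℓ - 2) * (m - 2))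

/-- The series `∑ g, φ g * X ^ level g` over all flags `g`. -/
noncomputable def levelSeries (φ : W → ℤ) : PowerSeries ℤ :=
  PowerSeries.mk fun n ↦ ∑ g ∈ (finite_level_eq cs hyp n).toFinset, φ g

open Classical in
/-- The indicator function of a predicate on flags. -/
noncomputable def ind (p : W → Prop) (g : W) : ℤ := if p g then 1 else 0

theorem levelSeries_add (φ ψ : W → ℤ) :
    levelSeries cs hyp (φ + ψ) = levelSeries cs hyp φ + levelSeries cs hyp ψ := by
  ext n; simp [levelSeries, Finset.sum_add_distrib]

theorem levelSeries_sub (φ ψ : W → ℤ) :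
    levelSeries cs hyp (φ - ψ) = levelSeries cs hyp φ - levelSeries cs hyp ψ := by
  ext n; simp [levelSeries, Finset.sum_sub_distrib]

theorem levelSeries_sum {ι : Type*} (s : Finset ι) (φ : ι → W → ℤ) :
    levelSeries cs hyp (∑ a ∈ s, φ a) = ∑ a ∈ s, levelSeries cs hyp (φ a) := by
  ext n
  simp only [levelSeries, PowerSeries.coeff_mk, Finset.sum_apply, map_sum]
  exact Finset.sum_comm

/-- Right translation by `p` multiplies the series by a power of `X` if it changes the level by a
constant. -/
theorem levelSeries_translate {φ ψ : W → ℤ} (p : W) (a : ℕ) (h : ∀ g, ψ (g * p) = φ g)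
    (hl : ∀ g, φ g ≠ 0 → level cs (g * p) = level cs g + a) :
    levelSeries cs hyp ψ = X ^ a * levelSeries cs hyp φ := by
  have h' : ∀ g, φ (g * p⁻¹) = ψ g := fun g ↦ by rw [← h, inv_mul_cancel_right]
  have hl' : ∀ g, ψ g ≠ 0 → level cs g = level cs (g * p⁻¹) + a := fun g hg ↦ by
    rw [← hl _ (by rwa [h']), inv_mul_cancel_right]
  ext n
  rw [PowerSeries.coeff_X_pow_mul']
  simp only [levelSeries, PowerSeries.coeff_mk]
  split_ifs with hn
  · refine Finset.sum_bij_ne_zero (fun g _ _ ↦ g * p⁻¹) ?_ ?_ ?_ ?_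
    · intro g hg h0
      have := hl' g h0
      simp only [Set.Finite.mem_toFinset, Set.mem_ofPred_eq] at hg ⊢
      omega
    · intro a _ _ b _ _ hab
      exact mul_right_cancel hab
    · intro g hg h0
      have := hl g h0
      simp only [Set.Finite.mem_toFinset, Set.mem_ofPred_eq] at hg ⊢
      exact ⟨g * p, by omega, by rwa [h], by simp⟩
    · intro g _ _
      rw [h']
  · refine Finset.sum_eq_zero fun g hg ↦ ?_
    by_contra h0
    have := hl' g h0
    simp only [Set.Finite.mem_toFinset, Set.mem_ofPred_eq] at hg
    omega

/-- The number of pairs of adjacent flags. -/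
theorem levelSeries_eq_two_mul {φ ψ : W → ℤ} (i : Fin 3) (hi : i ≠ 0)
    (hφ : ∀ g, φ g = ψ g + ψ (g * cs.simple i)) :
    levelSeries cs hyp φ = 2 * levelSeries cs hyp ψ := by
  have : φ = ψ + fun g ↦ ψ (g * cs.simple i) := funext hφ
  rw [this, levelSeries_add, levelSeries_translate (φ := ψ) (ψ := fun g ↦ ψ (g * cs.simple i)) cs hyp
      (cs.simple i) 0 (fun g ↦ by simp)
    (fun g _ ↦ level_mul_simple_of_ne_zero cs hyp g hi)]
  ring

theorem isRightDescent_mul_self_iff (g : W) (i : Fin 3) :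
    cs.IsRightDescent (g * cs.simple i) i ↔ ¬cs.IsRightDescent g i := by
  rw [isRightDescent_iff_not_isRightDescent_mul, simple_mul_simple_cancel_right]

theorem levelSeries_one_eq_two_mul (i : Fin 3) (hi : i ≠ 0) :
    levelSeries cs hyp 1 = 2 * levelSeries cs hyp (ind fun g ↦ ¬cs.IsRightDescent g i) := by
  refine levelSeries_eq_two_mul cs hyp i hi fun g ↦ ?_
  have := isRightDescent_mul_self_iff cs g i
  by_cases h : cs.IsRightDescent g i <;> simp_all [ind]

theorem levelSeries_edges :
    levelSeries cs hyp (ind fun g ↦ ¬cs.IsRightDescent g 0) =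
      2 * levelSeries cs hyp (ind fun g ↦ ¬cs.IsRightDescent g 0 ∧ ¬cs.IsRightDescent g 2) := by
  refine levelSeries_eq_two_mul cs hyp 2 (by decide) fun g ↦ ?_
  have h1 := isRightDescent_mul_self_iff cs g 2
  have h2 := cs.isRightDescent_mul_simple_iff matrix_ne_zero (g := g)
    (matrix_two_zero (hℓ := hℓ) (hm := hm))
  by_cases h : cs.IsRightDescent g 0 <;> by_cases h' : cs.IsRightDescent g 2 <;>
    simp [ind, h1, h2, h, h']

theorem one_eq_sum_residueElt {i j : Fin 3} (hij : i ≠ j) :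
    (1 : W → ℤ) = ∑ a ∈ Finset.univ ×ˢ Finset.range (tessellationMatrix ℓ m hℓ hm i j),
      fun g ↦ ind (fun g ↦ ¬cs.IsRightDescent g i ∧ ¬cs.IsRightDescent g j)
        (g * (cs.residueElt i j a)⁻¹) := by
  funext g
  obtain ⟨a, ⟨ha, hai, haj⟩, hu⟩ := cs.existsUnique_residueElt matrix_ne_zero g hij
  rw [Finset.sum_apply, Finset.sum_eq_single_of_mem a (by simpa using ha)]
  · simp [ind, hai, haj]
  · intro b hb hba
    rw [ind, if_neg]
    exact fun h ↦ hba (hu b ⟨by simpa using hb, h⟩)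

theorem levelSeries_vertices :
    levelSeries cs hyp 1 = 2 * ℓ *
      levelSeries cs hyp (ind fun g ↦ ¬cs.IsRightDescent g 1 ∧ ¬cs.IsRightDescent g 2) := by
  rw [one_eq_sum_residueElt cs (i := 1) (j := 2) (by decide), levelSeries_sum,
    Finset.sum_congr rfl fun a _ ↦ levelSeries_translate cs hyp (cs.residueElt 1 2 a) 0
      (fun g ↦ by rw [mul_inv_cancel_right])
      (fun g _ ↦ level_mul_of_mem cs hyp g (cs.residueElt_mem_closure 1 2 a))]
  simp [matrix_one_two]

include hyp in
theorem ind_isFaceMin (g : W) : ind (IsFaceMin cs) g =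
    ind (fun g ↦ IsFaceMin cs g ∧ ¬IsFlatFaceMin cs g) g + ind (IsFlatFaceMin cs) g := by
  have : IsFlatFaceMin cs g → IsFaceMin cs g := fun h ↦ h.isFaceMin cs hyp
  by_cases h : IsFlatFaceMin cs g
  · simp [ind, h, this h]
  · by_cases h' : IsFaceMin cs g <;> simp [ind, h, h']

theorem levelSeries_faces :
    levelSeries cs hyp 1 =
      2 * (∑ k ∈ Finset.range m, X ^ ((k + 1) / 2)) *
          levelSeries cs hyp (ind fun g ↦ IsFaceMin cs g ∧ ¬IsFlatFaceMin cs g) +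
        (∑ k ∈ Finset.range m, X ^ ((k + 1) / 2 - 1) + ∑ k ∈ Finset.range m, X ^ ((k + 1) / 2)) *
          levelSeries cs hyp (ind (IsFlatFaceMin cs)) := by
  have hne : ∀ (p : W → Prop) g, ind p g ≠ 0 → p g := fun p g h ↦ by
    by_contra hp; exact h (by simp [ind, hp])
  -- The correction for flat faces applies only to the side that starts along the bottom edge. At `k
  -- = 0` no step has been taken, and the truncated 0 - 1 = 0 is the right exponent.
  have key : ∀ a ∈ (Finset.univ : Finset Bool) ×ˢ Finset.range m,
      levelSeries cs hyp (fun g ↦ ind (IsFaceMin cs) (g * (cs.residueElt 0 1 a)⁻¹)) =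
        X ^ ((a.2 + 1) / 2) *
          levelSeries cs hyp (ind fun g ↦ IsFaceMin cs g ∧ ¬IsFlatFaceMin cs g) +
        X ^ (if a.1 then (a.2 + 1) / 2 - 1 else (a.2 + 1) / 2) *
          levelSeries cs hyp (ind (IsFlatFaceMin cs)) := by
    rintro ⟨b, k⟩ ha
    have hk : k < m := by simpa using ha
    have : (fun g ↦ ind (IsFaceMin cs) (g * (cs.residueElt 0 1 (b, k))⁻¹)) =
        (fun g ↦ ind (fun g ↦ IsFaceMin cs g ∧ ¬IsFlatFaceMin cs g)
          (g * (cs.residueElt 0 1 (b, k))⁻¹)) +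
        fun g ↦ ind (IsFlatFaceMin cs) (g * (cs.residueElt 0 1 (b, k))⁻¹) := by
      funext g
      exact ind_isFaceMin cs hyp _
    rw [this, levelSeries_add]
    congr 1
    · refine levelSeries_translate cs hyp (cs.residueElt 0 1 (b, k)) _
        (fun g ↦ by rw [mul_inv_cancel_right]) fun g hg ↦ ?_
      obtain ⟨hf, hn⟩ := hne _ g hg
      cases b
      · exact level_mul_altProd_right cs hyp hf hk
      · have := level_mul_altProd_left cs hyp hf hk
        rwa [if_neg (by tauto), add_zero] at this
    · refine levelSeries_translate cs hyp (cs.residueElt 0 1 (b, k)) _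
        (fun g ↦ by rw [mul_inv_cancel_right]) fun g hg ↦ ?_
      have hf := hne _ g hg
      cases b
      · exact level_mul_altProd_right cs hyp (hf.isFaceMin cs hyp) hk
      · have := level_mul_altProd_left cs hyp (hf.isFaceMin cs hyp) hk
        simp only [hf, true_and] at this
        simp only [residueElt, if_true]
        split_ifs at this <;> omega
  rw [one_eq_sum_residueElt cs (i := 0) (j := 1) (by decide), levelSeries_sum, matrix_zero_one]
  refine (Finset.sum_congr rfl key).trans ?_
  rw [Finset.sum_product]
  simp only [Fintype.sum_bool, if_true, Finset.sum_add_distrib, ← Finset.sum_mul, Bool.false_eq_true,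
    if_false]
  ring

open Classical in
-- For odd m, passing through the top edge is a bijection from non-flat faces to flat ones, and it
-- raises the lowest level by m / 2.
theorem levelSeries_flat :
    levelSeries cs hyp (ind (IsFlatFaceMin cs)) = if Odd m then
      X ^ (m / 2) * levelSeries cs hyp (ind fun g ↦ IsFaceMin cs g ∧ ¬IsFlatFaceMin cs g)
    else 0 := by
  split_ifs with ho
  · refine levelSeries_translate cs hyp (topRotation cs * cs.simple 2) _ (fun g ↦ ?_) fun g hg ↦ ?_
    · rw [ind, ind]
      congr 1
      rw [eq_iff_iff]
      constructor
      · intro h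
        obtain ⟨-, w, hw, hw', e⟩ := h.exists_eq
        rw [mul_assoc] at e
        rw [mul_right_cancel e]
        exact ⟨hw, hw'⟩
      · rintro ⟨h, h'⟩
        rw [← mul_assoc]
        exact isFlatFaceMin_of_not cs ho h hyp h'
    · have h : IsFaceMin cs g ∧ ¬IsFlatFaceMin cs g := by
        by_contra hp; exact hg (by simp [ind, hp])
      rw [← mul_assoc, level_mul_simple_of_ne_zero cs hyp _ (by decide),
        level_mul_topRotation cs hyp ho h.1 h.2]
  · have : ind (IsFlatFaceMin cs) = 0 := by
      funext g
      rw [ind, if_neg fun h ↦ ho h.exists_eq.1]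
      rfl
    rw [this]
    ext n
    simp [levelSeries]

/-- A horizontal edge is met from its two sides, as the top of a non-flat face and as the bottom of
a flat one, at the same level. -/
theorem levelSeries_horizontal :
    levelSeries cs hyp (ind fun g ↦ ¬cs.IsRightDescent g 0 ∧ IsHorizontal cs g) =
      2 * levelSeries cs hyp (ind (IsFlatFaceMin cs)) := by
  classical
  have : (ind fun g ↦ ¬cs.IsRightDescent g 0 ∧ IsHorizontal cs g) =
      ind (IsFlatFaceMin cs) + fun g ↦ if Odd m then
        ind (fun g ↦ IsFaceMin cs g ∧ ¬IsFlatFaceMin cs g) (g * (topRotation cs)⁻¹) else 0 := by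
    funext g
    have hflat : IsFlatFaceMin cs g → IsFaceMin cs g := fun h ↦ h.isFaceMin cs hyp
    have htop0 : Odd m → IsFaceMin cs (g * (topRotation cs)⁻¹) → ¬cs.IsRightDescent g 0 :=
      fun ho h ↦ by
        have := topRotation_not_zero cs ho h
        rwa [inv_mul_cancel_right] at this
    have htop1 : IsFaceMin cs (g * (topRotation cs)⁻¹) → cs.IsRightDescent g 1 := fun h ↦ by
      have := topRotation_one cs h
      rwa [inv_mul_cancel_right] at this
    rw [Pi.add_apply]
    simp only [ind, IsHorizontal]
    by_cases hf : IsFlatFaceMin cs g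
    · have h1 := hflat hf
      have h2 : ¬IsFaceMin cs (g * (topRotation cs)⁻¹) := fun h ↦ h1.2 (htop1 h)
      simp [hf, h1.1, h2]
    · by_cases ho : Odd m
      · by_cases hA : IsFaceMin cs (g * (topRotation cs)⁻¹)
        · simp [hf, ho, hA, htop0 ho hA]
        · simp [hf, hA]
      · simp [hf, ho]
  rw [this, levelSeries_add, two_mul]
  congr 1
  rw [levelSeries_flat]
  split_ifs with ho
  · refine levelSeries_translate cs hyp (topRotation cs) _ (fun g ↦ by rw [mul_inv_cancel_right])
      fun g hg ↦ ?_
    have h : IsFaceMin cs g ∧ ¬IsFlatFaceMin cs g := by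
      by_contra hp; exact hg (by simp [ind, hp])
    exact level_mul_topRotation cs hyp ho h.1 h.2
  · ext n
    simp [levelSeries]

/-- Pairing the flags at the two ends of an edge gives the factor 1 + X for an ordinary edge and 2
for a horizontal one; the correction is 2 - (1 + X) = 1 - X. -/
theorem levelSeries_edge_ends :
    levelSeries cs hyp 1 =
      (1 + X) * levelSeries cs hyp (ind fun g ↦ ¬cs.IsRightDescent g 0) +
        (1 - X) * (2 * levelSeries cs hyp (ind (IsFlatFaceMin cs))) := by
  classical
  rw [← levelSeries_horizontal]
  set φ : W → ℤ := ind fun g ↦ ¬cs.IsRightDescent g 0 ∧ IsHorizontal cs g with hφ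
  set ψ : W → ℤ := ind fun g ↦ ¬cs.IsRightDescent g 0 ∧ ¬IsHorizontal cs g with hψ
  have h0 : (ind fun g ↦ ¬cs.IsRightDescent g 0) = φ + ψ := by
    funext g
    by_cases h : cs.IsRightDescent g 0 <;> by_cases h' : IsHorizontal cs g <;>
      simp [hφ, hψ, ind, h, h']
  have h1 : (1 : W → ℤ) = φ + ψ + ((fun g ↦ φ (g * cs.simple 0)) +
      fun g ↦ ψ (g * cs.simple 0)) := by
    funext g
    have := isRightDescent_mul_self_iff cs g 0
    by_cases h : cs.IsRightDescent g 0 <;> by_cases h' : IsHorizontal cs g <;>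
      by_cases h'' : IsHorizontal cs (g * cs.simple 0) <;>
      simp [hφ, hψ, ind, h, h', h'', this]
  have hne : ∀ (p : W → Prop) g, ind p g ≠ 0 → p g := fun p g h ↦ by
    by_contra hp; exact h (by simp [ind, hp])
  rw [h1, h0, levelSeries_add, levelSeries_add, levelSeries_add,
    levelSeries_translate (φ := φ) (ψ := fun g ↦ φ (g * cs.simple 0)) cs hyp (cs.simple 0) 0 (fun g ↦ by simp) (fun g hg ↦ by
      have := hne _ g hg
      rw [level_mul_zero cs hyp this.1, if_pos this.2]),
    levelSeries_translate (φ := ψ) (ψ := fun g ↦ ψ (g * cs.simple 0)) cs hyp (cs.simple 0) 1 (fun g ↦ by simp) (fun g hg ↦ by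
      have := hne _ g hg
      rw [level_mul_zero cs hyp this.1, if_neg this.2])]
  ring

/-- Inclusion-exclusion over the proper sets of generators avoiding the descent set of `g`
contributes 1 if that set is empty or full, and 0 otherwise. It is empty only for `g = 1`, and never
full. -/
theorem levelSeries_euler :
    levelSeries cs hyp 1 - levelSeries cs hyp (ind fun g ↦ ¬cs.IsRightDescent g 0) -
      levelSeries cs hyp (ind fun g ↦ ¬cs.IsRightDescent g 1) -
      levelSeries cs hyp (ind fun g ↦ ¬cs.IsRightDescent g 2) +
      levelSeries cs hyp (ind (IsFaceMin cs)) +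
      levelSeries cs hyp (ind fun g ↦ ¬cs.IsRightDescent g 0 ∧ ¬cs.IsRightDescent g 2) +
      levelSeries cs hyp (ind fun g ↦ ¬cs.IsRightDescent g 1 ∧ ¬cs.IsRightDescent g 2) = 1 := by
  classical
  simp only [← levelSeries_add, ← levelSeries_sub]
  have : (1 - (ind fun g ↦ ¬cs.IsRightDescent g 0) - (ind fun g ↦ ¬cs.IsRightDescent g 1) -
      (ind fun g ↦ ¬cs.IsRightDescent g 2) + ind (IsFaceMin cs) +
      (ind fun g ↦ ¬cs.IsRightDescent g 0 ∧ ¬cs.IsRightDescent g 2) +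
      (ind fun g ↦ ¬cs.IsRightDescent g 1 ∧ ¬cs.IsRightDescent g 2) : W → ℤ) =
      fun g ↦ if g = 1 then 1 else 0 := by
    funext g
    have htriple : cs.IsRightDescent g 0 → cs.IsRightDescent g 1 → ¬cs.IsRightDescent g 2 :=
      not_forall_isRightDescent cs hyp
    have hone := fun i ↦ cs.not_isRightDescent_one i
    have hex : g ≠ 1 → ¬cs.IsRightDescent g 1 → ¬cs.IsRightDescent g 2 →
      cs.IsRightDescent g 0 := isRightDescent_zero_of_ne_one cs
    simp only [Pi.add_apply, Pi.sub_apply, Pi.one_apply, ind, IsFaceMin]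
    rcases eq_or_ne g 1 with rfl | hg
    · simp [hone]
    · rw [if_neg hg]
      by_cases h0 : cs.IsRightDescent g 0 <;> by_cases h1 : cs.IsRightDescent g 1 <;>
        by_cases h2 : cs.IsRightDescent g 2 <;> simp_all
  rw [this]
  ext n
  rw [levelSeries, PowerSeries.coeff_mk, Finset.sum_ite_eq', PowerSeries.coeff_one]
  simp [level_one, eq_comm]

end Gen

/-! ### Closed forms of the face sums -/

section Rational

variable {R : Type*} [CommRing R]

theorem sub_one_mul_sum_pow_even (x : R) (k : ℕ) :
    (x - 1) * ∑ j ∈ Finset.range (2 * k), x ^ ((j + 1) / 2) = (1 + x) * (x ^ k - 1) := by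
  induction k with
  | zero => simp
  | succ k ih =>
    have e1 : (2 * k + 1) / 2 = k := by omega
    have e2 : (2 * k + 1 + 1) / 2 = k + 1 := by omega
    rw [mul_add, mul_one, Finset.sum_range_succ, Finset.sum_range_succ, e1, e2, mul_add, mul_add, ih]
    ring

theorem sub_one_mul_sum_pow_odd (x : R) (k : ℕ) :
    (x - 1) * ∑ j ∈ Finset.range (2 * k + 1), x ^ ((j + 1) / 2) =
      (1 + x) * (x ^ k - 1) + x ^ k * (x - 1) := by
  have e1 : (2 * k + 1) / 2 = k := by omega
  rw [Finset.sum_range_succ, mul_add, sub_one_mul_sum_pow_even, e1]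
  ring

theorem sub_one_mul_sum_pow_odd_sub_one (x : R) (k : ℕ) :
    (x - 1) * ∑ j ∈ Finset.range (2 * k + 1), x ^ ((j + 1) / 2 - 1) =
      2 * (x ^ k - 1) + (x - 1) := by
  induction k with
  | zero => simp
  | succ k ih =>
    have e1 : (2 * k + 1 + 1) / 2 - 1 = k := by omega
    have e2 : (2 * k + 1 + 1 + 1) / 2 - 1 = k := by omega
    rw [mul_add, mul_one, Finset.sum_range_succ, Finset.sum_range_succ, e1, e2, mul_add, mul_add, ih]
    ring

end Rational

/-! ### The growth series as a rational function -/

section Series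

open PowerSeries (X)

variable {ℓ m : ℕ} {hℓ : 3 ≤ ℓ} {hm : 3 ≤ m} {W : Type*} [Group W]
  (cs : CoxeterSystem (tessellationMatrix ℓ m hℓ hm) W) (hyp : 4 < (ℓ - 2) * (m - 2))

theorem one_add_X_ne_zero : (1 + X : PowerSeries ℤ) ≠ 0 := fun h ↦ by
  have := congrArg (PowerSeries.coeff 0) h
  simp at this

theorem two_ne_zero_powerSeries : (2 : PowerSeries ℤ) ≠ 0 := fun h ↦ by
  have := congrArg PowerSeries.constantCoeff h
  rw [map_ofNat, map_zero] at this
  exact two_ne_zero this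

theorem levelSeries_mul_even {k : ℕ} (hk : m = 2 * k) :
    levelSeries cs hyp (ind fun g ↦ ¬cs.IsRightDescent g 1 ∧ ¬cs.IsRightDescent g 2) *
        (X ^ (k + 1) - (ℓ - 1 : PowerSeries ℤ) * X ^ k + (ℓ - 1 : PowerSeries ℤ) * X - 1) = (1 + X) * (X ^ k - 1) := by
  have ho : ¬Odd m := by rw [Nat.not_odd_iff_even, hk]; exact even_two_mul k
  have h1 := levelSeries_one_eq_two_mul cs hyp 1 (by decide)
  have h2 := levelSeries_one_eq_two_mul cs hyp 2 (by decide)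
  have h3 := levelSeries_edges cs hyp
  have h4 := levelSeries_vertices cs hyp
  have h5 := levelSeries_faces cs hyp
  have h6 := levelSeries_flat cs hyp
  have h7 := levelSeries_edge_ends cs hyp
  have h8 := levelSeries_euler cs hyp
  have h9 : levelSeries cs hyp (ind (IsFaceMin cs)) = _ :=
    (congrArg _ (funext (ind_isFaceMin cs hyp))).trans (levelSeries_add cs hyp _ _)
  rw [if_neg ho] at h6
  rw [h6] at h5 h7 h9
  rw [h9] at h8
  have hS := sub_one_mul_sum_pow_even (X : PowerSeries ℤ) k
  rw [← hk] at hS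
  generalize levelSeries cs hyp 1 = G at *
  generalize levelSeries cs hyp (ind fun g ↦ ¬cs.IsRightDescent g 1 ∧ ¬cs.IsRightDescent g 2) = F at *
  generalize levelSeries cs hyp (ind fun g ↦ ¬cs.IsRightDescent g 0) = E0 at *
  generalize levelSeries cs hyp (ind fun g ↦ ¬cs.IsRightDescent g 1) = E1 at *
  generalize levelSeries cs hyp (ind fun g ↦ ¬cs.IsRightDescent g 2) = E2 at *
  generalize levelSeries cs hyp (ind fun g ↦ ¬cs.IsRightDescent g 0 ∧ ¬cs.IsRightDescent g 2) = E at *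
  generalize levelSeries cs hyp (ind fun g ↦ IsFaceMin cs g ∧ ¬IsFlatFaceMin cs g) = A at *
  generalize ∑ j ∈ Finset.range m, (X : PowerSeries ℤ) ^ ((j + 1) / 2) = S at *
  have a1 : (ℓ : PowerSeries ℤ) * F = (1 + X) * E := by
    apply mul_left_cancel₀ two_ne_zero_powerSeries
    linear_combination h7 - h4 + (1 + X) * h3
  have a2 : (ℓ : PowerSeries ℤ) * F = S * A := by
    apply mul_left_cancel₀ two_ne_zero_powerSeries
    linear_combination h5 - h4
  -- Since G = 2 E1 = 2 E2 and E0 = 2 E, the seven-term relation collapses to vertices - edges +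
  -- faces = 1. Eliminating E and A by `a1` and `a2` leaves F.
  have a3 : F - E + A = 1 := by
    apply mul_left_cancel₀ two_ne_zero_powerSeries
    linear_combination 2 * h8 + 2 * h3 - h1 - h2
  apply mul_left_cancel₀ one_add_X_ne_zero
  rw [pow_succ]
  generalize (X : PowerSeries ℤ) ^ k = Y at *
  linear_combination ((1 + X) - (1 + X) * F + ℓ * F) * hS + (1 + X) * (X - 1) * S * a3 -
    (X - 1) * S * a1 + (1 + X) * (X - 1) * a2

theorem levelSeries_mul_odd {k : ℕ} (hk : m = 2 * k + 1) :
    levelSeries cs hyp (ind fun g ↦ ¬cs.IsRightDescent g 1 ∧ ¬cs.IsRightDescent g 2) *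
        (X ^ (2 * k + 1) - (ℓ - 1 : PowerSeries ℤ) * X ^ (2 * k) + 2 * X ^ (k + 1) - 2 * X ^ k +
          (ℓ - 1 : PowerSeries ℤ) * X - 1) =
      (1 + X) * (X ^ (2 * k) - 1) + 2 * X ^ k * (X - 1) := by
  have ho : Odd m := ⟨k, hk⟩
  have h1 := levelSeries_one_eq_two_mul cs hyp 1 (by decide)
  have h2 := levelSeries_one_eq_two_mul cs hyp 2 (by decide)
  have h3 := levelSeries_edges cs hyp
  have h4 := levelSeries_vertices cs hyp
  have h5 := levelSeries_faces cs hyp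
  have h6 := levelSeries_flat cs hyp
  have h7 := levelSeries_edge_ends cs hyp
  have h8 := levelSeries_euler cs hyp
  have h9 : levelSeries cs hyp (ind (IsFaceMin cs)) = _ :=
    (congrArg _ (funext (ind_isFaceMin cs hyp))).trans (levelSeries_add cs hyp _ _)
  have hmk : m / 2 = k := by omega
  rw [if_pos ho, hmk] at h6
  rw [h6] at h5 h7 h9
  rw [h9] at h8
  have hS := sub_one_mul_sum_pow_odd (X : PowerSeries ℤ) k
  have hS' := sub_one_mul_sum_pow_odd_sub_one (X : PowerSeries ℤ) k
  rw [← hk] at hS hS'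
  generalize levelSeries cs hyp 1 = G at *
  generalize levelSeries cs hyp (ind fun g ↦ ¬cs.IsRightDescent g 1 ∧ ¬cs.IsRightDescent g 2) = F at *
  generalize levelSeries cs hyp (ind fun g ↦ ¬cs.IsRightDescent g 0) = E0 at *
  generalize levelSeries cs hyp (ind fun g ↦ ¬cs.IsRightDescent g 1) = E1 at *
  generalize levelSeries cs hyp (ind fun g ↦ ¬cs.IsRightDescent g 2) = E2 at *
  generalize levelSeries cs hyp (ind fun g ↦ ¬cs.IsRightDescent g 0 ∧ ¬cs.IsRightDescent g 2) = E at *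
  generalize levelSeries cs hyp (ind fun g ↦ IsFaceMin cs g ∧ ¬IsFlatFaceMin cs g) = A at *
  generalize ∑ j ∈ Finset.range m, (X : PowerSeries ℤ) ^ ((j + 1) / 2) = S at *
  generalize ∑ j ∈ Finset.range m, (X : PowerSeries ℤ) ^ ((j + 1) / 2 - 1) = S' at *
  rw [pow_succ, pow_succ, mul_comm 2 k, pow_mul]
  generalize (X : PowerSeries ℤ) ^ k = Y at *
  have a1 : (ℓ : PowerSeries ℤ) * F = (1 + X) * E + (1 - X) * (Y * A) := by
    apply mul_left_cancel₀ two_ne_zero_powerSeries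
    linear_combination h7 - h4 + (1 + X) * h3
  -- Here A counts the non-flat faces and Y * A the flat ones.
  have a3 : F - E + A + Y * A = 1 := by
    apply mul_left_cancel₀ two_ne_zero_powerSeries
    linear_combination 2 * h8 + 2 * h3 - h1 - h2
  have b2 : (X - 1) * (ℓ : PowerSeries ℤ) * F = ((1 + X) * (Y ^ 2 - 1) + 2 * Y * (X - 1)) * A := by
    apply mul_left_cancel₀ two_ne_zero_powerSeries
    linear_combination (X - 1) * (h5 - h4) + (2 * A + Y * A) * hS + Y * A * hS'
  apply mul_left_cancel₀ one_add_X_ne_zero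
  linear_combination -((1 + X) * (Y ^ 2 - 1) + 2 * Y * (X - 1)) * a1 +
    (1 + X) * ((1 + X) * (Y ^ 2 - 1) + 2 * Y * (X - 1)) * a3 + (1 + X + 2 * Y) * b2

end Series

end Tessellation

/-! ### Partial fractions, asymptotics and the Salem property -/

section PartialFractions

open Polynomial

theorem PowerSeries.coeff_succ_mul_X_sub_C (F : PowerSeries ℂ) (r : ℂ) (n : ℕ) :
    PowerSeries.coeff (n + 1) (F * (PowerSeries.X - PowerSeries.C r)) =
      PowerSeries.coeff n F - r * PowerSeries.coeff (n + 1) F := by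
  rw [mul_sub, map_sub, PowerSeries.coeff_succ_mul_X, PowerSeries.coeff_mul_C, mul_comm]

theorem Polynomial.coeff_toPowerSeries_eq_zero (N : ℂ[X]) {n : ℕ} (hn : N.natDegree < n) :
    PowerSeries.coeff n (N : PowerSeries ℂ) = 0 := by
  rw [Polynomial.coeff_coe, Polynomial.coeff_eq_zero_of_natDegree_lt hn]

/-- The coefficients of a rational function with simple poles are eventually a linear combination of
geometric progressions. -/
theorem PowerSeries.exists_coeff_eq_sum_of_mul_prod_eq (s : Finset ℂ) (h0 : 0 ∉ s)
    (F : PowerSeries ℂ) (N : ℂ[X])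
    (h : F * ∏ r ∈ s, (PowerSeries.X - PowerSeries.C r) = N) :
    ∃ (c : ℂ → ℂ) (n₀ : ℕ), ∀ n ≥ n₀, PowerSeries.coeff n F = ∑ r ∈ s, c r * r⁻¹ ^ n := by
  induction s using Finset.induction_on generalizing F with
  | empty =>
    rw [Finset.prod_empty, mul_one] at h
    exact ⟨0, N.natDegree + 1, fun n hn ↦ by
      rw [h, N.coeff_toPowerSeries_eq_zero hn, Finset.sum_empty]⟩
  | insert r s hr ih =>
    rw [Finset.mem_insert, not_or] at h0
    rw [Finset.prod_insert hr, ← mul_assoc] at h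
    obtain ⟨c, n₀, hc⟩ := ih h0.2 _ h
    have hr0 : r ≠ 0 := fun e ↦ h0.1 e.symm
    have hs0 : ∀ a ∈ s, a ≠ 0 := fun a ha e ↦ h0.2 (e ▸ ha)
    have hsr : ∀ a ∈ s, a - r ≠ 0 := fun a ha e ↦ hr (sub_eq_zero.mp e ▸ ha)
    -- Dividing by X - r divides the coefficient at a pole `a` by a - r. What remains satisfies the
    -- homogeneous first-order recursion, hence is a multiple of r⁻¹ ^ n.
    set G : ℕ → ℂ := fun n ↦ PowerSeries.coeff n F - ∑ a ∈ s, c a / (a - r) * a⁻¹ ^ n with hG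
    have hstep : ∀ n ≥ n₀, G (n + 1) = r⁻¹ * G n := by
      intro n hn
      have h1 := hc (n + 1) (by omega)
      rw [PowerSeries.coeff_succ_mul_X_sub_C] at h1
      have h2 : r * ∑ a ∈ s, c a / (a - r) * a⁻¹ ^ (n + 1) =
          ∑ a ∈ s, c a / (a - r) * a⁻¹ ^ n - ∑ a ∈ s, c a * a⁻¹ ^ (n + 1) := by
        rw [Finset.mul_sum, ← Finset.sum_sub_distrib]
        refine Finset.sum_congr rfl fun a ha ↦ ?_
        have := hs0 a ha
        have := hsr a ha
        rw [pow_succ]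
        field_simp
        ring
      rw [eq_inv_mul_iff_mul_eq₀ hr0]
      simp only [hG, mul_sub, h2]
      linear_combination -h1
    have hgeom : ∀ k, G (n₀ + k) = r⁻¹ ^ k * G n₀ := fun k ↦ by
      induction k with
      | zero => simp
      | succ k ihk => rw [← add_assoc, hstep _ (by omega), ihk, pow_succ', mul_assoc]
    classical
    refine ⟨fun a ↦ if a = r then G n₀ * r ^ n₀ else c a / (a - r), n₀, fun n hn ↦ ?_⟩
    obtain ⟨k, rfl⟩ := Nat.exists_eq_add_of_le hn
    have h5 : ∑ a ∈ s, (if a = r then G n₀ * r ^ n₀ else c a / (a - r)) * a⁻¹ ^ (n₀ + k) =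
        ∑ a ∈ s, c a / (a - r) * a⁻¹ ^ (n₀ + k) :=
      Finset.sum_congr rfl fun a ha ↦ by rw [if_neg (ne_of_mem_of_not_mem ha hr)]
    rw [Finset.sum_insert hr, h5]
    beta_reduce
    rw [if_pos rfl]
    have h3 := hgeom k
    have h4 : G n₀ * r ^ n₀ * r⁻¹ ^ (n₀ + k) = r⁻¹ ^ k * G n₀ := by
      rw [pow_add, inv_pow, inv_pow]
      field_simp
    rw [h4, ← h3, hG]
    ring

theorem PowerSeries.exists_norm_coeff_mul_prod_le (s : Finset ℂ) (F : PowerSeries ℂ) (b : ℝ)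
    (hF : ∀ n, ‖PowerSeries.coeff n F‖ ≤ b) :
    ∃ b', ∀ n, ‖PowerSeries.coeff n (F * ∏ r ∈ s, (PowerSeries.X - PowerSeries.C r))‖ ≤ b' := by
  induction s using Finset.induction_on generalizing F b with
  | empty => exact ⟨b, by simpa using hF⟩
  | insert r s hr ih =>
    rw [Finset.prod_insert hr, ← mul_assoc]
    refine ih _ (b + ‖r‖ * b) fun n ↦ ?_
    have hb : 0 ≤ b := (norm_nonneg _).trans (hF 0)
    rcases n with _ | n
    · rw [mul_sub, map_sub, PowerSeries.coeff_zero_mul_X, PowerSeries.coeff_mul_C, zero_sub, norm_neg,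
        norm_mul, mul_comm]
      have := mul_le_mul_of_nonneg_left (hF 0) (norm_nonneg r)
      linarith
    · rw [PowerSeries.coeff_succ_mul_X_sub_C]
      refine (norm_sub_le _ _).trans (add_le_add (hF n) ?_)
      rw [norm_mul]
      exact mul_le_mul_of_nonneg_left (hF _) (norm_nonneg r)

/-- A power series with bounded coefficients has no pole inside the unit disc. -/
theorem PowerSeries.eval_eq_zero_of_norm_coeff_le {F : PowerSeries ℂ} {b : ℝ}
    (hF : ∀ n, ‖PowerSeries.coeff n F‖ ≤ b) {s : Finset ℂ} {a : ℂ} (ha : a ∈ s) (ha0 : a ≠ 0)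
    (ha1 : ‖a‖ < 1) {N : ℂ[X]}
    (h : F * ∏ r ∈ s, (PowerSeries.X - PowerSeries.C r) = N) : N.eval a = 0 := by
  obtain ⟨b', hb'⟩ := PowerSeries.exists_norm_coeff_mul_prod_le (s.erase a) F b hF
  rw [← Finset.prod_erase_mul _ _ ha, ← mul_assoc] at h
  set H := F * ∏ r ∈ s.erase a, (PowerSeries.X - PowerSeries.C r)
  -- With the other factors absorbed in `H`, this recursion, boundedness and ‖a‖ < 1 force the tail
  -- of `H` to vanish. So `H` is a polynomial, and X - a divides `N`.
  have hstep : ∀ n ≥ N.natDegree, PowerSeries.coeff n H = a * PowerSeries.coeff (n + 1) H := by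
    intro n hn
    have h1 := PowerSeries.coeff_succ_mul_X_sub_C H a n
    rw [h, N.coeff_toPowerSeries_eq_zero (by omega)] at h1
    exact (sub_eq_zero.mp h1.symm)
  have hzero : ∀ n ≥ N.natDegree, PowerSeries.coeff n H = 0 := by
    intro n hn
    have hk : ∀ k, PowerSeries.coeff n H = a ^ k * PowerSeries.coeff (n + k) H := fun k ↦ by
      induction k with
      | zero => simp
      | succ k ihk => rw [ihk, hstep (n + k) (by omega), pow_succ, mul_assoc, add_assoc]
    have hlim : Filter.Tendsto (fun k ↦ ‖a‖ ^ k * b') Filter.atTop (nhds (0 * b')) :=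
      (tendsto_pow_atTop_nhds_zero_of_lt_one (norm_nonneg a) ha1).mul_const b'
    rw [zero_mul] at hlim
    have : ‖PowerSeries.coeff n H‖ ≤ 0 := by
      refine ge_of_tendsto' hlim fun k ↦ ?_
      rw [hk k, norm_mul, norm_pow]
      exact mul_le_mul_of_nonneg_left (hb' _) (by positivity)
    exact norm_le_zero_iff.mp this
  have hH : H = ((PowerSeries.trunc N.natDegree H : ℂ[X]) : PowerSeries ℂ) := by
    ext n
    rw [Polynomial.coeff_coe, PowerSeries.coeff_trunc]
    split_ifs with hn
    · rfl
    · exact hzero n (by omega)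
  have hN : N = PowerSeries.trunc N.natDegree H * (Polynomial.X - Polynomial.C a : ℂ[X]) := by
    apply Polynomial.coe_injective
    rw [Polynomial.coe_mul, ← hH, Polynomial.coe_sub, Polynomial.coe_X, Polynomial.coe_C, h]
  simpa using congrArg (Polynomial.eval a) hN

/-- Integer sequences with a rational generating function whose poles are simple and lie on the unit
circle, apart from `λ` and `λ⁻¹`, grow like a multiple of `λ ^ n` up to a bounded error. -/
theorem exists_asymptotics {f : ℕ → ℕ} {D N : ℤ[X]} {T : Finset ℂ} {lam : ℝ} (hlam : 1 < lam)
    (hD : D.map (Int.castRingHom ℂ) = ∏ r ∈ T, (X - C r))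
    (hT : ∀ r ∈ T, r = lam ∨ r = (lam : ℂ)⁻¹ ∨ ‖r‖ = 1) (hmem : (lam : ℂ)⁻¹ ∈ T)
    (hf : PowerSeries.mk (fun n ↦ (f n : ℤ)) * (D : PowerSeries ℤ) = (N : PowerSeries ℤ))
    (hN : (N.map (Int.castRingHom ℂ)).eval (lam : ℂ)⁻¹ ≠ 0) :
    ∃ K R : ℝ, 0 < K ∧ 0 < R ∧ ∀ n, K * lam ^ n - R < f n ∧ (f n : ℝ) < K * lam ^ n + R := by
  have hlam0 : (lam : ℂ) ≠ 0 := by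
    rw [Complex.ofReal_ne_zero]; linarith
  have hnlam : ‖(lam : ℂ)‖ = lam := by
    rw [Complex.norm_real, Real.norm_of_nonneg (by linarith)]
  set F : PowerSeries ℂ := PowerSeries.mk fun n ↦ (f n : ℂ) with hFdef
  have hF : F * ∏ r ∈ T, (PowerSeries.X - PowerSeries.C r) =
      (N.map (Int.castRingHom ℂ) : PowerSeries ℂ) := by
    have h1 := congrArg (PowerSeries.map (Int.castRingHom ℂ)) hf
    rw [map_mul, ← Polynomial.polynomial_map_coe, ← Polynomial.polynomial_map_coe, hD] at h1
    rw [← h1]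
    have h2 : PowerSeries.map (Int.castRingHom ℂ) (PowerSeries.mk fun n ↦ (f n : ℤ)) = F := by
      ext n; simp [hFdef]
    have h3 : ((∏ r ∈ T, (X - C r) : ℂ[X]) : PowerSeries ℂ) =
        ∏ r ∈ T, (PowerSeries.X - PowerSeries.C r) := by
      refine (map_prod (Polynomial.coeToPowerSeries.ringHom (R := ℂ)) _ T).trans ?_
      simp
    rw [h2, h3]
  have hT0 : (0 : ℂ) ∉ T := fun h ↦ by
    rcases hT 0 h with h | h | h
    · exact hlam0 h.symm
    · exact inv_ne_zero hlam0 h.symm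
    · simp at h
  obtain ⟨c, n₀, hc⟩ := PowerSeries.exists_coeff_eq_sum_of_mul_prod_eq T hT0 F _ hF
  set K := (c (lam : ℂ)⁻¹).re with hK
  set b := ∑ r ∈ T.erase (lam : ℂ)⁻¹, ‖c r‖ with hb
  have hb0 : 0 ≤ b := Finset.sum_nonneg fun _ _ ↦ norm_nonneg _
  have hlarge : ∀ n ≥ n₀, |(f n : ℝ) - K * lam ^ n| ≤ b := by
    intro n hn
    have h1 := hc n hn
    rw [← Finset.add_sum_erase _ _ hmem, hFdef, PowerSeries.coeff_mk, inv_inv] at h1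
    have h2 : (f n : ℝ) - K * lam ^ n =
        (∑ r ∈ T.erase (lam : ℂ)⁻¹, c r * r⁻¹ ^ n).re := by
      have h3 := congrArg Complex.re h1
      rw [Complex.add_re, Complex.natCast_re, ← Complex.ofReal_pow, Complex.re_mul_ofReal] at h3
      rw [h3, hK]; ring
    rw [h2]
    refine (Complex.abs_re_le_norm _).trans ((norm_sum_le _ _).trans (Finset.sum_le_sum fun r hr ↦ ?_))
    rw [norm_mul, norm_pow, norm_inv]
    refine mul_le_of_le_one_right (norm_nonneg _) (pow_le_one₀ (by positivity) ?_)
    rcases hT r (Finset.mem_of_mem_erase hr) with h | h | h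
    · rw [h, hnlam]; exact inv_le_one_of_one_le₀ hlam.le
    · exact absurd h (Finset.ne_of_mem_erase hr)
    · rw [h, inv_one]
  set R := b + 1 + ∑ n ∈ Finset.range n₀, |(f n : ℝ) - K * lam ^ n| with hR
  have hsum0 : 0 ≤ ∑ n ∈ Finset.range n₀, |(f n : ℝ) - K * lam ^ n| :=
    Finset.sum_nonneg fun _ _ ↦ abs_nonneg _
  have hall : ∀ n, |(f n : ℝ) - K * lam ^ n| < R := by
    intro n
    rcases lt_or_ge n n₀ with hn | hn
    · have := Finset.single_le_sum (f := fun n ↦ |(f n : ℝ) - K * lam ^ n|)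
        (fun _ _ ↦ abs_nonneg _) (Finset.mem_range.mpr hn)
      linarith
    · have := hlarge n hn
      linarith
  refine ⟨K, R, ?_, by linarith, fun n ↦ ?_⟩
  · by_contra! hK0
    -- With K ≤ 0 the nonnegative sequence would be bounded by R, so the factor at λ⁻¹ would have to
    -- cancel against `N`.
    refine hN (PowerSeries.eval_eq_zero_of_norm_coeff_le (F := F) (b := R) (fun n ↦ ?_) hmem
      (inv_ne_zero hlam0) ?_ hF)
    · rw [hFdef, PowerSeries.coeff_mk, Complex.norm_natCast]
      have h1 := (abs_lt.mp (hall n)).2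
      have h2 : K * lam ^ n ≤ 0 := mul_nonpos_of_nonpos_of_nonneg hK0 (by positivity)
      linarith
    · rw [norm_inv, hnlam]; exact inv_lt_one_of_one_lt₀ hlam
  · have := abs_lt.mp (hall n)
    constructor <;> linarith

/-- A root `λ > 1` of a monic integer polynomial with constant term `±1` is a Salem number if all other
roots except `λ⁻¹` lie on the unit circle. -/
theorem isSalemNumber_of_root {D : ℤ[X]} (hD : D.Monic) (hD0 : IsUnit (D.coeff 0)) {lam : ℝ}
    (hlam : 1 < lam) (hroot : aeval lam D = 0)
    (hT : ∀ z : ℂ, aeval z D = 0 → z = lam ∨ z = (lam : ℂ)⁻¹ ∨ ‖z‖ = 1) :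
    IsSalemNumber lam := by
  have hint : IsIntegral ℤ lam := ⟨D, hD, hroot⟩
  have hmin : minpoly ℚ lam = (minpoly ℤ lam).map (algebraMap ℤ ℚ) :=
    minpoly.isIntegrallyClosed_eq_field_fractions' ℚ hint
  have hdvd : minpoly ℤ lam ∣ D := minpoly.isIntegrallyClosed_dvd hint hroot
  have hz : ∀ z : ℂ, aeval z (minpoly ℚ lam) = 0 → z = lam ∨ z = (lam : ℂ)⁻¹ ∨ ‖z‖ = 1 := by
    intro z h
    apply hT
    obtain ⟨q, hq⟩ := hdvd
    rw [hmin, aeval_map_algebraMap] at h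
    rw [hq, map_mul, h, zero_mul]
  refine ⟨hlam, hint, ?_, fun z h h1 h2 ↦ ((hz z h).resolve_left h1).resolve_left h2⟩
  by_contra hinv
  have hinvC : aeval (lam : ℂ)⁻¹ (minpoly ℚ lam) ≠ 0 := by
    intro h
    apply hinv
    have : ((lam : ℂ))⁻¹ = algebraMap ℝ ℂ lam⁻¹ := by simp
    rw [this, aeval_algebraMap_apply] at h
    simpa using h
  set P : ℂ[X] := (minpoly ℤ lam).map (Int.castRingHom ℂ) with hP
  have hPm : P.Monic := (minpoly.monic hint).map _
  have hPz : ∀ z, z ∈ P.roots ↔ aeval z (minpoly ℚ lam) = 0 := by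
    intro z
    rw [mem_roots hPm.ne_zero, IsRoot, hP, hmin, aeval_map_algebraMap, eval_map, aeval_def]
    rfl
  have hlamroot : (lam : ℂ) ∈ P.roots := by
    rw [hPz]
    have : (lam : ℂ) = algebraMap ℝ ℂ lam := rfl
    rw [this, aeval_algebraMap_apply, minpoly.aeval, map_zero]
  -- The constant term of the minimal polynomial divides a unit. Without λ⁻¹ every conjugate would
  -- have modulus at least 1, and the product would have modulus at least λ > 1.
  have hprod : ‖P.roots.prod‖ = 1 := by
    have h1 := (IsAlgClosed.splits P).coeff_zero_eq_prod_roots_of_monic hPm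
    have h2 : IsUnit ((minpoly ℤ lam).coeff 0) := by
      obtain ⟨q, hq⟩ := hdvd
      rw [hq, mul_coeff_zero] at hD0
      exact isUnit_of_mul_isUnit_left hD0
    have h3 : ‖P.coeff 0‖ = 1 := by
      rw [hP, coeff_map]
      rcases Int.isUnit_iff.mp h2 with h | h <;> simp [h]
    rw [h1, norm_mul, norm_pow, norm_neg, norm_one, one_pow, one_mul] at h3
    exact h3
  obtain ⟨t, ht⟩ := Multiset.exists_cons_of_mem hlamroot
  have ht1 : 1 ≤ ‖t.prod‖ := by
    refine Multiset.prod_induction (fun z ↦ 1 ≤ ‖z‖) t (fun a b ha hb ↦ ?_) (by simp) fun z hzt ↦ ?_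
    · rw [norm_mul]; exact one_le_mul_of_one_le_of_one_le ha hb
    · have hzP : z ∈ P.roots := ht ▸ Multiset.mem_cons_of_mem hzt
      have hz0 := (hPz z).mp hzP
      rcases hz z hz0 with h | h | h
      · rw [h, Complex.norm_real, Real.norm_of_nonneg (by linarith)]; exact hlam.le
      · exact absurd (h ▸ hz0) hinvC
      · exact h.ge
  rw [ht, Multiset.prod_cons, norm_mul, Complex.norm_real, Real.norm_of_nonneg (by linarith)] at hprod
  nlinarith

end PartialFractions

/-! ### The roots of the denominator -/

section GrowthPolynomial

open Polynomial

/-- The denominator of the growth series: `ε = 0` for an even number of sides, `ε = 1` for an odd one. -/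
noncomputable def growthDenominator (c p q : ℕ) (ε : ℤ) : ℤ[X] :=
  X ^ (p + 2) - C (c : ℤ) * X ^ (p + 1) + C (c : ℤ) * X - 1 + C (2 * ε) * (X ^ (q + 1) - X ^ q)

namespace growthDenominator

theorem aeval_eq {A : Type*} [CommRing A] (c p q : ℕ) (ε : ℤ) (x : A) :
    aeval x (growthDenominator c p q ε) =
      x ^ (p + 2) - c * x ^ (p + 1) + c * x - 1 + 2 * ε * (x ^ (q + 1) - x ^ q) := by
  simp [growthDenominator, map_ofNat]

theorem coe_eq (c p q : ℕ) (ε : ℤ) :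
    (growthDenominator c p q ε : PowerSeries ℤ) =
      PowerSeries.X ^ (p + 2) - (c : PowerSeries ℤ) * PowerSeries.X ^ (p + 1) +
        (c : PowerSeries ℤ) * PowerSeries.X - 1 +
        2 * (ε : PowerSeries ℤ) * (PowerSeries.X ^ (q + 1) - PowerSeries.X ^ q) := by
  have h2 : ((2 : ℤ[X]) : PowerSeries ℤ) = 2 := Polynomial.coe_C 2
  have hc : (((c : ℤ[X])) : PowerSeries ℤ) = c := map_natCast (Polynomial.coeToPowerSeries.ringHom (R := ℤ)) c
  have he : (((ε : ℤ[X])) : PowerSeries ℤ) = ε := map_intCast (Polynomial.coeToPowerSeries.ringHom (R := ℤ)) ε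
  simp [growthDenominator, h2, hc, he]

theorem natDegree_eq_and_monic {c p q : ℕ} {ε : ℤ} (hq : q ≤ p) :
    (growthDenominator c p q ε).natDegree = p + 2 ∧ (growthDenominator c p q ε).Monic := by
  have h : growthDenominator c p q ε = X ^ (p + 2) + (- C (c : ℤ) * X ^ (p + 1) + C (c : ℤ) * X - 1 +
      C (2 * ε) * (X ^ (q + 1) - X ^ q)) := by
    rw [growthDenominator]; ring
  have hdeg : (- C (c : ℤ) * X ^ (p + 1) + C (c : ℤ) * X - 1 +
      C (2 * ε) * (X ^ (q + 1) - X ^ q) : ℤ[X]).natDegree ≤ p + 1 := by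
    compute_degree
    omega
  have hlt : (- C (c : ℤ) * X ^ (p + 1) + C (c : ℤ) * X - 1 +
      C (2 * ε) * (X ^ (q + 1) - X ^ q) : ℤ[X]).degree < ((p + 2 : ℕ) : WithBot ℕ) :=
    degree_le_natDegree.trans_lt (by exact_mod_cast Nat.lt_succ_of_le hdeg)
  rw [h]
  refine ⟨natDegree_eq_of_degree_eq_some ?_, monic_X_pow_add hlt⟩
  rw [degree_add_eq_left_of_degree_lt (by rwa [degree_X_pow]), degree_X_pow]

theorem isUnit_coeff_zero {c p q : ℕ} {ε : ℤ} (hε : ε = 0 ∨ ε = 1 ∧ 2 * q = p + 1) :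
    IsUnit ((growthDenominator c p q ε).coeff 0) := by
  have h := aeval_eq c p q ε (0 : ℤ)
  rw [coeff_zero_eq_eval_zero, ← coe_aeval_eq_eval, h]
  rcases hε with rfl | ⟨rfl, hq⟩
  · simp
  · have : q ≠ 0 := by omega
    simp [this]

/-- The restriction of the growth denominator to the unit circle, in the angular coordinate. -/
noncomputable def circle (c p : ℕ) (ε : ℤ) (φ : ℝ) : ℝ :=
  Real.sin ((p + 2) * φ) - c * Real.sin (p * φ) + 2 * ε * Real.sin φ

/-- Antireciprocity gives D(e^{2iφ}) = 2i e^{i(p+2)φ} `circle c p ε φ`; the condition 2q = p + 1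
centres the middle terms. -/
theorem aeval_exp_eq_zero {c p q : ℕ} {ε : ℤ} (hε : ε = 0 ∨ ε = 1 ∧ 2 * q = p + 1) {φ : ℝ}
    (hφ : circle c p ε φ = 0) :
    aeval (Complex.exp (2 * φ * Complex.I)) (growthDenominator c p q ε) = 0 := by
  have hsin : ∀ n : ℕ, Complex.sin (n * φ) * 2 * Complex.exp (φ * Complex.I) ^ n =
      -Complex.I * (Complex.exp (φ * Complex.I) ^ (2 * n) - 1) := by
    intro n
    rw [Complex.sin, two_mul n, pow_add, ← Complex.exp_nat_mul, neg_mul, Complex.exp_neg, mul_assoc]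
    have := Complex.exp_ne_zero (n * (φ * Complex.I))
    field_simp
    ring
  have h0 : Complex.sin ((p + 2 : ℕ) * φ) - c * Complex.sin ((p : ℕ) * φ) +
      2 * ε * Complex.sin ((1 : ℕ) * φ) = 0 := by
    have := congrArg (fun x : ℝ ↦ (x : ℂ)) hφ
    simpa [circle] using this
  have h1 := hsin (p + 2)
  have h2 := hsin p
  have h3 := hsin 1
  rw [aeval_eq, mul_assoc, two_mul, Complex.exp_add]
  set w := Complex.exp (φ * Complex.I)
  apply mul_left_cancel₀ Complex.I_ne_zero
  rcases hε with rfl | ⟨rfl, hq⟩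
  · simp only [Int.cast_zero, mul_zero, zero_mul, add_zero] at h0 ⊢
    linear_combination (-2 * w ^ (p + 2)) * h0 + h1 - c * w ^ 2 * h2
  · simp only [Int.cast_one] at h0 ⊢
    have hp : w ^ p * w = (w ^ q) ^ 2 := by rw [← pow_succ, ← hq, mul_comm, pow_mul]
    linear_combination (-2 * w ^ (p + 2)) * h0 + h1 - c * w ^ 2 * h2 +
      2 * w ^ (p + 1) * h3 - Complex.I * 2 * (w ^ 2 - 1) * hp

/-- At these points sin(pφ) = (-1)^j and cos(pφ) = 0. With s = sin φ ≥ 0 the value is at most 1 + 2s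
- 2s² - c, and 1 + 2s - 2s² ≤ 3/2 < c. -/
theorem neg_one_pow_mul_circle_neg {c p : ℕ} {ε : ℤ} (hε : ε = 0 ∨ ε = 1) (hc : 2 ≤ c) {j : ℕ}
    (hj : j < p) : (-1) ^ j * circle c p ε ((j + 1 / 2) * Real.pi / p) < 0 := by
  set a := (j + 1 / 2) * Real.pi / p with ha
  have hp : (0 : ℝ) < p := by exact_mod_cast (Nat.zero_le j).trans_lt hj
  have hpa : p * a = Real.pi / 2 + j * Real.pi := by rw [ha]; field_simp; ring
  have hsin : Real.sin (p * a) = (-1) ^ j := by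
    rw [hpa, Real.sin_add_nat_mul_pi, Real.sin_pi_div_two, mul_one]
  have hcos : Real.cos (p * a) = 0 := by
    rw [hpa, Real.cos_add_nat_mul_pi, Real.cos_pi_div_two, mul_zero]
  have hs : 0 ≤ Real.sin a := by
    apply Real.sin_nonneg_of_nonneg_of_le_pi (by positivity)
    rw [ha, div_le_iff₀ hp, mul_comm]
    gcongr
    have : (j : ℝ) + 1 ≤ p := by exact_mod_cast hj
    linarith
  have hc' : (2 : ℝ) ≤ c := by exact_mod_cast hc
  rw [circle, add_mul, Real.sin_add, hsin, hcos, Real.cos_two_mul', Real.cos_sq']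
  have hs1 := Real.sin_le_one a
  generalize Real.sin a = s at *
  rcases neg_one_pow_eq_or ℝ j with h | h <;> rw [h] <;> rcases hε with rfl | rfl <;> push_cast <;>
    nlinarith [sq_nonneg (2 * s - 1), sq_nonneg s]

theorem exists_circle_eq_zero {c p : ℕ} {ε : ℤ} (hε : ε = 0 ∨ ε = 1) (hc : 2 ≤ c) {j : ℕ}
    (hj : j + 1 < p) :
    ∃ φ : ℝ, (j + 1 / 2) * Real.pi / p < φ ∧ φ < (j + 1 + 1 / 2) * Real.pi / p ∧
      circle c p ε φ = 0 := by
  have h1 := neg_one_pow_mul_circle_neg (c := c) hε hc (Nat.lt_of_succ_lt hj)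
  have h2 := neg_one_pow_mul_circle_neg (c := c) hε hc hj
  have hp : (0 : ℝ) < p := by exact_mod_cast (Nat.zero_le _).trans_lt hj
  push_cast at h2
  set a := (j + 1 / 2) * Real.pi / (p : ℝ)
  set b := (j + 1 + 1 / 2) * Real.pi / (p : ℝ)
  have hab : a < b := by
    have := Real.pi_pos
    simp only [a, b]
    gcongr
    linarith
  have hcont : ContinuousOn (fun φ ↦ (-1) ^ j * circle c p ε φ) (Set.Icc a b) := by
    unfold circle; fun_prop
  have h3 : 0 < (-1) ^ j * circle c p ε b := by rw [pow_succ] at h2; linarith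
  obtain ⟨φ, hφ, h0⟩ := intermediate_value_Ioo hab.le hcont ⟨h1, h3⟩
  exact ⟨φ, hφ.1, hφ.2, (mul_eq_zero.mp h0).resolve_left (by simp)⟩

/-- D(1) = 0 and D'(1) = p + 2 + 2ε - cp < 0, so D is negative just to the right of 1, whereas D(c)
= c² - 1 + 2ε(c^{q+1} - c^q) is positive. -/
theorem exists_real_root {c p q : ℕ} {ε : ℤ} (hε : ε = 0 ∨ ε = 1) (hc : 2 ≤ c)
    (h : p + 2 + 2 * ε < c * p) :
    ∃ lam : ℝ, 1 < lam ∧ aeval lam (growthDenominator c p q ε) = 0 := by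
  have hc' : (2 : ℝ) ≤ c := by exact_mod_cast hc
  have hderiv := (growthDenominator c p q ε).hasDerivAt_aeval (1 : ℝ)
  have hneg : aeval (1 : ℝ) (derivative (growthDenominator c p q ε)) < 0 := by
    have h' : (p + 2 + 2 * ε : ℝ) < c * p := by exact_mod_cast h
    simp only [growthDenominator, derivative_X_pow, derivative_mul, derivative_C, derivative_X,
      derivative_one, map_add, map_sub, map_mul, map_pow, aeval_C, aeval_X, one_pow, map_zero, map_one,
      map_natCast, map_ofNat]
    simp
    linarith
  have hslope := (hasDerivAt_iff_tendsto_slope.mp hderiv).mono_left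
    (nhdsWithin_mono (1 : ℝ) (s := Set.Ioi 1) fun x (hx : 1 < x) ↦ hx.ne')
  obtain ⟨x, hx, hxc, hx1⟩ := ((hslope.eventually_lt_const hneg).and ((eventually_nhdsWithin_of_eventually_nhds
    (eventually_lt_nhds (by linarith : (1 : ℝ) < c))).and self_mem_nhdsWithin)).exists
  have hx1 : (1 : ℝ) < x := hx1
  have hone : aeval (1 : ℝ) (growthDenominator c p q ε) = 0 := by rw [aeval_eq]; simp
  rw [slope_def_field, hone, sub_zero, div_neg_iff] at hx
  have hxneg : aeval x (growthDenominator c p q ε) < 0 := by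
    rcases hx with hx | hx
    · linarith [hx.2]
    · exact hx.1
  have hcpos : 0 < aeval (c : ℝ) (growthDenominator c p q ε) := by
    have h1 : (1 : ℝ) ≤ c ^ q := one_le_pow₀ (by linarith)
    rw [aeval_eq]
    rcases hε with rfl | rfl <;> push_cast <;> ring_nf <;> nlinarith
  obtain ⟨lam, hlam, h0⟩ := intermediate_value_Ioo hxc.le
    (growthDenominator c p q ε).continuous_aeval.continuousOn ⟨hxneg, hcpos⟩
  exact ⟨lam, hx1.trans hlam.1, h0⟩

theorem aeval_inv_eq_zero {K : Type*} [Field K] {c p q : ℕ} {ε : ℤ}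
    (hε : ε = 0 ∨ ε = 1 ∧ 2 * q = p + 1) {x : K} (hx0 : x ≠ 0)
    (hx : aeval x (growthDenominator c p q ε) = 0) :
    aeval x⁻¹ (growthDenominator c p q ε) = 0 := by
  rw [aeval_eq] at hx ⊢
  apply mul_left_cancel₀ (pow_ne_zero (p + 2) hx0)
  have h1 : x ^ (p + 2) * x⁻¹ ^ (p + 2) = 1 := by rw [← mul_pow, mul_inv_cancel₀ hx0, one_pow]
  have h2 : x ^ (p + 2) * x⁻¹ ^ (p + 1) = x := by
    rw [inv_pow]; field_simp; ring
  have h3 : x ^ (p + 2) * x⁻¹ = x ^ (p + 1) := by field_simp; ring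
  rcases hε with rfl | ⟨rfl, hq⟩
  · simp only [Int.cast_zero, mul_zero, zero_mul, add_zero] at hx ⊢
    linear_combination -hx + h1 - c * h2 + c * h3
  · have h4 : x ^ (p + 2) = x ^ q * x ^ (q + 1) := by rw [← pow_add]; congr 1; omega
    have h5 : x ^ (p + 2) * x⁻¹ ^ (q + 1) = x ^ q := by rw [h4, inv_pow]; field_simp
    have h6 : x ^ (p + 2) * x⁻¹ ^ q = x ^ (q + 1) := by rw [h4, inv_pow]; field_simp
    simp only [Int.cast_one] at hx ⊢
    linear_combination -hx + h1 - c * h2 + c * h3 + 2 * h5 - 2 * h6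

/-- The p - 1 zeros of `circle` in (0, π) give distinct roots e^{2iφ} ≠ 1. With 1, λ and λ⁻¹ these
are p + 2 roots, the degree of D, so there are no others and none is multiple. -/
theorem exists_roots {c p q : ℕ} {ε : ℤ} (hε : ε = 0 ∨ ε = 1 ∧ 2 * q = p + 1) (hq : q ≤ p)
    (hp : 1 ≤ p) (hc : 2 ≤ c) (h : p + 2 + 2 * ε < c * p) :
    ∃ (lam : ℝ) (T : Finset ℂ), 1 < lam ∧
      (growthDenominator c p q ε).map (Int.castRingHom ℂ) = ∏ r ∈ T, (X - C r) ∧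
      (∀ r ∈ T, r = lam ∨ r = (lam : ℂ)⁻¹ ∨ ‖r‖ = 1) ∧ (lam : ℂ)⁻¹ ∈ T ∧
      aeval lam (growthDenominator c p q ε) = 0 := by
  have hε' : ε = 0 ∨ ε = 1 := hε.imp_right And.left
  obtain ⟨lam, hlam, hroot⟩ := exists_real_root (q := q) hε' hc h
  have hlam0 : lam ≠ 0 := by linarith
  have hp0 : (0 : ℝ) < p := by exact_mod_cast hp
  choose φ hφ1 hφ2 hφ0 using fun j : Fin (p - 1) ↦
    exists_circle_eq_zero (c := c) (p := p) (j := j) hε' hc (by omega)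
  have hφpos : ∀ j, 0 < φ j := fun j ↦ lt_trans (by have := Real.pi_pos; positivity) (hφ1 j)
  have hφpi : ∀ j, φ j < Real.pi := fun j ↦ (hφ2 j).trans_le (by
    rw [div_le_iff₀ hp0, mul_comm]
    have : ((j : ℕ) : ℝ) + 2 ≤ p := by exact_mod_cast (by omega : (j : ℕ) + 2 ≤ p)
    have := Real.pi_pos
    gcongr
    linarith)
  have hmono : ∀ i j, i < j → φ i < φ j := by
    intro i j hij
    refine (hφ2 i).trans_le (le_trans ?_ (hφ1 j).le)
    have : ((i : ℕ) : ℝ) + 1 ≤ (j : ℕ) := by exact_mod_cast hij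
    have := Real.pi_pos
    gcongr
  set z : Fin (p - 1) → ℂ := fun j ↦ Complex.exp (2 * φ j * Complex.I) with hz
  have hexp : ∀ x y : ℝ, |x - y| < Real.pi →
      Complex.exp (2 * x * Complex.I) = Complex.exp (2 * y * Complex.I) → x = y := by
    intro x y hxy he
    obtain ⟨n, hn⟩ := Complex.exp_eq_exp_iff_exists_int.mp he
    have h1 : (x : ℂ) = y + n * Real.pi := by
      apply mul_left_cancel₀ (mul_ne_zero two_ne_zero Complex.I_ne_zero)
      linear_combination hn
    have h2 : x = y + n * Real.pi := by exact_mod_cast h1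
    have hpi := Real.pi_pos
    rw [h2, add_sub_cancel_left, abs_mul, abs_of_pos hpi] at hxy
    have h3 : |(n : ℝ)| < 1 := by nlinarith
    have h4 : n = 0 := by
      rw [← Int.abs_lt_one_iff]; exact_mod_cast h3
    rw [h2, h4]; simp
  have hzinj : Function.Injective z := by
    have : Function.Injective φ := StrictMono.injective fun i j ↦ hmono i j
    refine fun i j hij ↦ this (hexp _ _ ?_ hij)
    rw [abs_lt]
    constructor <;> linarith [hφpos i, hφpos j, hφpi i, hφpi j]
  have hz1 : ∀ j, z j ≠ 1 := fun j hj ↦ by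
    refine (hφpos j).ne' (hexp _ 0 ?_ (by simpa using hj))
    rw [sub_zero, abs_of_pos (hφpos j)]
    exact hφpi j
  have hznorm : ∀ j, ‖z j‖ = 1 := fun j ↦ by
    have := Complex.norm_exp_ofReal_mul_I (2 * φ j)
    push_cast at this
    exact this
  have hnlam : ‖(lam : ℂ)‖ = lam := by
    rw [Complex.norm_real, Real.norm_of_nonneg (by linarith)]
  have hnlam' : ‖(lam : ℂ)⁻¹‖ < 1 := by
    rw [norm_inv, hnlam]; exact inv_lt_one_of_one_lt₀ hlam
  classical
  set T₀ : Finset ℂ := Finset.univ.image z with hT₀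
  have hT₀norm : ∀ r ∈ T₀, ‖r‖ = 1 := fun r hr ↦ by
    obtain ⟨j, -, rfl⟩ := Finset.mem_image.mp hr
    exact hznorm j
  have hmem1 : (1 : ℂ) ∉ T₀ := fun hr ↦ by
    obtain ⟨j, -, hj⟩ := Finset.mem_image.mp hr
    exact hz1 j hj
  have hmem2 : (lam : ℂ)⁻¹ ∉ insert (1 : ℂ) T₀ := fun hr ↦ by
    rcases Finset.mem_insert.mp hr with e | e
    · rw [e, norm_one] at hnlam'; exact lt_irrefl _ hnlam'
    · exact hnlam'.ne (hT₀norm _ e)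
  have hmem3 : (lam : ℂ) ∉ insert (lam : ℂ)⁻¹ (insert (1 : ℂ) T₀) := fun hr ↦ by
    rcases Finset.mem_insert.mp hr with e | e
    · rw [← e, hnlam] at hnlam'; linarith
    rcases Finset.mem_insert.mp e with e | e
    · rw [e, norm_one] at hnlam; linarith
    · have := hT₀norm _ e; linarith
  set T := insert (lam : ℂ) (insert (lam : ℂ)⁻¹ (insert (1 : ℂ) T₀)) with hT
  have hcard : T.card = p + 2 := by
    rw [hT, Finset.card_insert_of_notMem hmem3, Finset.card_insert_of_notMem hmem2,
      Finset.card_insert_of_notMem hmem1, hT₀, Finset.card_image_of_injective _ hzinj, Finset.card_univ,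
      Fintype.card_fin]
    omega
  obtain ⟨hdeg, hmonic⟩ := natDegree_eq_and_monic (c := c) (ε := ε) hq
  have hrootC : aeval (lam : ℂ) (growthDenominator c p q ε) = 0 := by
    have : (lam : ℂ) = algebraMap ℝ ℂ lam := rfl
    rw [this, aeval_algebraMap_apply, hroot, map_zero]
  set P := (growthDenominator c p q ε).map (Int.castRingHom ℂ) with hP
  have hPmonic : P.Monic := hmonic.map _
  have hPdeg : P.natDegree = p + 2 := by rw [hP, hmonic.natDegree_map, hdeg]
  have hTroot : ∀ r ∈ T, aeval r (growthDenominator c p q ε) = 0 := by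
    intro r hr
    simp only [hT, hT₀, Finset.mem_insert, Finset.mem_image, Finset.mem_univ, true_and] at hr
    rcases hr with rfl | rfl | rfl | ⟨j, rfl⟩
    · exact hrootC
    · exact aeval_inv_eq_zero hε (by exact_mod_cast hlam0) hrootC
    · rw [aeval_eq]; simp
    · exact aeval_exp_eq_zero hε (hφ0 j)
  have hle : T.val ≤ P.roots := by
    rw [Multiset.le_iff_subset T.nodup]
    intro r hr
    rw [mem_roots hPmonic.ne_zero, IsRoot, hP, eval_map]
    exact hTroot r hr
  have hroots : T.val = P.roots := Multiset.eq_of_le_of_card_le hle (by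
    rw [Finset.card_val, hcard, ← hPdeg]; exact P.card_roots')
  refine ⟨lam, T, hlam, ?_, fun r hr ↦ ?_, by simp [hT], hroot⟩
  · have := prod_multiset_X_sub_C_of_monic_of_roots_card_eq hPmonic
      (by rw [← hroots, Finset.card_val, hcard, hPdeg])
    rw [← this, ← hroots]
    rfl
  · simp only [hT, Finset.mem_insert] at hr
    rcases hr with rfl | rfl | rfl | hr
    · exact Or.inl rfl
    · exact Or.inr (Or.inl rfl)
    · exact Or.inr (Or.inr norm_one)
    · exact Or.inr (Or.inr (hT₀norm r hr))

theorem exists_isSalemNumber_and_asymptotics {c p q : ℕ} {ε : ℤ}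
    (hε : ε = 0 ∨ ε = 1 ∧ 2 * q = p + 1) (hq : q ≤ p) (hp : 1 ≤ p) (hc : 2 ≤ c)
    (h : p + 2 + 2 * ε < c * p) {f : ℕ → ℕ} {N : ℤ[X]}
    (hf : PowerSeries.mk (fun n ↦ (f n : ℤ)) * (growthDenominator c p q ε : PowerSeries ℤ) =
      (N : PowerSeries ℤ))
    (hN : ∀ x : ℝ, 0 < x → x < 1 → aeval x N ≠ 0) :
    ∃ K lam R : ℝ, 0 < K ∧ 1 < lam ∧ 0 < R ∧
      (∀ n, K * lam ^ n - R < f n ∧ (f n : ℝ) < K * lam ^ n + R) ∧ IsSalemNumber lam := by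
  obtain ⟨lam, T, hlam, hD, hT, hmem, hroot⟩ := exists_roots hε hq hp hc h
  obtain ⟨K, R, hK, hR, hKR⟩ := exists_asymptotics hlam hD hT hmem hf (by
    have h1 := hN lam⁻¹ (by positivity) (inv_lt_one_of_one_lt₀ hlam)
    have h2 : (lam : ℂ)⁻¹ = algebraMap ℝ ℂ lam⁻¹ := by simp
    rw [eval_map, ← algebraMap_int_eq, ← aeval_def, h2, aeval_algebraMap_apply]
    simpa using h1)
  refine ⟨K, lam, R, hK, hlam, hR, hKR, isSalemNumber_of_root (natDegree_eq_and_monic hq).2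
    (isUnit_coeff_zero hε) hlam hroot fun z hz ↦ ?_⟩
  rw [aeval_def, algebraMap_int_eq, ← eval_map, hD, eval_prod, Finset.prod_eq_zero_iff] at hz
  obtain ⟨r, hr, hr0⟩ := hz
  have : z = r := by simpa [sub_eq_zero] using hr0
  exact this ▸ hT r hr

end growthDenominator

end GrowthPolynomial

/-! ### Assembling the theorem for even and odd m -/

namespace Tessellation

open CoxeterSystem

variable {ℓ m : ℕ} {hℓ : 3 ≤ ℓ} {hm : 3 ≤ m}

local notation "cs₀" => CoxeterMatrix.toCoxeterSystem (tessellationMatrix ℓ m hℓ hm)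

theorem mk_coeff_growthSeries (hyp : 4 < (ℓ - 2) * (m - 2)) (o : TessellationVertex ℓ m hℓ hm) :
    (PowerSeries.mk fun n ↦
        ((PowerSeries.coeff n (growthSeries (tessellationGraph ℓ m hℓ hm) o) : ℕ) : ℤ)) =
      levelSeries cs₀ hyp (ind fun g ↦ ¬(cs₀).IsRightDescent g 1 ∧ ¬(cs₀).IsRightDescent g 2) := by
  classical
  ext n
  rw [PowerSeries.coeff_mk, growthSeries, PowerSeries.coeff_mk, ncard_graphSphere hyp, levelSeries,
    PowerSeries.coeff_mk]
  trans (((finite_level_eq cs₀ hyp n).toFinset.filter fun g ↦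
    ¬(cs₀).IsRightDescent g 1 ∧ ¬(cs₀).IsRightDescent g 2).card : ℤ)
  · rw [← Set.ncard_coe_finset]
    congr 2
    ext g
    simp
  · rw [Finset.card_filter, Nat.cast_sum]
    exact Finset.sum_congr rfl fun g _ ↦ by simp [ind]

theorem exists_growth_asymptotics_of_even (hyp : 4 < (ℓ - 2) * (m - 2))
    (o : TessellationVertex ℓ m hℓ hm) {p : ℕ} (hp : m = 2 * (p + 1)) :
    ∃ K lam R : ℝ, 0 < K ∧ 1 < lam ∧ 0 < R ∧
      (∀ n : ℕ,
        K * lam ^ n - R <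
            ((PowerSeries.coeff n (growthSeries (tessellationGraph ℓ m hℓ hm) o) : ℕ) : ℝ) ∧
          ((PowerSeries.coeff n (growthSeries (tessellationGraph ℓ m hℓ hm) o) : ℕ) : ℝ) <
            K * lam ^ n + R) ∧
      IsSalemNumber lam := by
  have hp1 : 1 ≤ p := by omega
  obtain ⟨c, hc⟩ : ∃ c, ℓ = c + 1 := ⟨ℓ - 1, by omega⟩
  refine growthDenominator.exists_isSalemNumber_and_asymptotics (c := c) (p := p) (q := 0) (ε := 0)
    (Or.inl rfl) (Nat.zero_le _) hp1 (by omega) ?_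
    (N := (1 + Polynomial.X) * (Polynomial.X ^ (p + 1) - 1)) ?_ fun x hx0 hx1 ↦ ?_
  -- With c = ℓ - 1 and m - 2 = 2p the hypothesis reads 2p(c - 1) > 4, which is p + 2 < cp.
  · obtain ⟨d, rfl⟩ : ∃ d, c = d + 1 := ⟨c - 1, by omega⟩
    have h1 : ℓ - 2 = d := by omega
    have h2 : m - 2 = 2 * p := by omega
    rw [h1, h2] at hyp
    push_cast
    nlinarith
  · rw [mk_coeff_growthSeries hyp]
    have h := levelSeries_mul_even cs₀ hyp hp
    have hcast : (ℓ - 1 : PowerSeries ℤ) = c := by rw [hc]; push_cast; ring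
    rw [hcast] at h
    rw [growthDenominator.coe_eq, Int.cast_zero, mul_zero, zero_mul, add_zero]
    push_cast
    linear_combination h
  · have : x ^ (p + 1) < 1 := pow_lt_one₀ hx0.le hx1 (Nat.succ_ne_zero p)
    simp only [map_mul, map_add, map_sub, map_one, map_pow, Polynomial.aeval_X]
    exact (mul_neg_of_pos_of_neg (by linarith) (by linarith)).ne

theorem exists_growth_asymptotics_of_odd (hyp : 4 < (ℓ - 2) * (m - 2))
    (o : TessellationVertex ℓ m hℓ hm) {k : ℕ} (hk : m = 2 * k + 1) :
    ∃ K lam R : ℝ, 0 < K ∧ 1 < lam ∧ 0 < R ∧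
      (∀ n : ℕ,
        K * lam ^ n - R <
            ((PowerSeries.coeff n (growthSeries (tessellationGraph ℓ m hℓ hm) o) : ℕ) : ℝ) ∧
          ((PowerSeries.coeff n (growthSeries (tessellationGraph ℓ m hℓ hm) o) : ℕ) : ℝ) <
            K * lam ^ n + R) ∧
      IsSalemNumber lam := by
  obtain ⟨p, hp⟩ : ∃ p, 2 * k = p + 1 := ⟨2 * k - 1, by omega⟩
  obtain ⟨c, hc⟩ : ∃ c, ℓ = c + 1 := ⟨ℓ - 1, by omega⟩
  refine growthDenominator.exists_isSalemNumber_and_asymptotics (c := c) (p := p) (q := k) (ε := 1)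
    (Or.inr ⟨rfl, hp⟩) (by omega) (by omega) (by omega) ?_
    (N := (1 + Polynomial.X) * (Polynomial.X ^ (2 * k) - 1) +
      2 * Polynomial.X ^ k * (Polynomial.X - 1)) ?_ fun x hx0 hx1 ↦ ?_
  -- Here m - 2 = p, so the hypothesis reads p(c - 1) > 4, which is p + 4 < cp.
  · obtain ⟨d, rfl⟩ : ∃ d, c = d + 1 := ⟨c - 1, by omega⟩
    have h1 : ℓ - 2 = d := by omega
    have h2 : m - 2 = p := by omega
    rw [h1, h2] at hyp
    push_cast
    nlinarith
  · rw [mk_coeff_growthSeries hyp]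
    have h := levelSeries_mul_odd cs₀ hyp hk
    have hcast : (ℓ - 1 : PowerSeries ℤ) = c := by rw [hc]; push_cast; ring
    rw [hcast, hp] at h
    have h2 : ((2 : Polynomial ℤ) : PowerSeries ℤ) = 2 := Polynomial.coe_C 2
    rw [growthDenominator.coe_eq, hp, Int.cast_one]
    push_cast [h2]
    linear_combination h
  · have h1 : x ^ (2 * k) < 1 := pow_lt_one₀ hx0.le hx1 (by omega)
    simp only [map_mul, map_add, map_sub, map_one, map_pow, Polynomial.aeval_X, map_ofNat]
    exact (add_neg (mul_neg_of_pos_of_neg (by linarith) (by linarith))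
      (mul_neg_of_pos_of_neg (by positivity) (by linarith))).ne

end Tessellation

theorem mainTheorem3 (ℓ m : ℕ) (hℓ : 3 ≤ ℓ) (hm : 3 ≤ m) (hyp : 4 < (ℓ - 2) * (m - 2))
    (o : TessellationVertex ℓ m hℓ hm) :
    (∀ n : ℕ, (graphSphere (tessellationGraph ℓ m hℓ hm) o n).Finite) ∧
      ∃ K lam R : ℝ, 0 < K ∧ 1 < lam ∧ 0 < R ∧
        (∀ n : ℕ,
          K * lam ^ n - R <
              ((PowerSeries.coeff n (growthSeries (tessellationGraph ℓ m hℓ hm) o) : ℕ) : ℝ) ∧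
            ((PowerSeries.coeff n (growthSeries (tessellationGraph ℓ m hℓ hm) o) : ℕ) : ℝ) <
              K * lam ^ n + R) ∧
        IsSalemNumber lam := by
  refine ⟨Tessellation.finite_graphSphere hyp o, ?_⟩
  rcases Nat.even_or_odd' m with ⟨k, hk | hk⟩
  · obtain ⟨p, rfl⟩ : ∃ p, k = p + 1 := ⟨k - 1, by omega⟩
    exact Tessellation.exists_growth_asymptotics_of_even hyp o hk
  · exact Tessellation.exists_growth_asymptotics_of_odd hyp o hk
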